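/- Let $(A,\mathfrak m)$ be a Gorenstein local ring, i.e. a commutative Noetherian local ring of finite injective dimension over itself. Let $\mathrm{CM}(A)$ be the category of maximal Cohen--Macaulay (MCM) $A$-modules, i.e. the finitely generated modules $M$ with $M=0$ or $\operatorname{depth} M=\dim A$, and let $\mathrm{ICM}(A)$ be its set of isomorphism classes, $\langle M\rangle$ being the class of $M$. Let $\underline{\mathrm{CM}}(A)$ be the stable category: it has the same objects, and morphisms $\operatorname{Hom}_A(M,N)/P(M,N)$, where $P(M,N)$ is the set of maps that factor through a finitely generated free module. Let $\underline{\mathrm{ICM}}(A)$ be its set of isomorphism classes, $[M]$ being the class of $M$. For $M\in\mathrm{CM}(A)$ choose a minimal surjection $\varepsilon\colon G\to M^*=\operatorname{Hom}_A(M,A)$ with $G$ finitely generated free, let $i\colon M\to M^{**}\to G^*=Q$ be the map induced by $\varepsilon^*$, and let $p\colon Q\to\Omega^{-1}(M)=\operatorname{coker} i$ be the co-syzygy of $M$. A morphism $f\colon M\to N$ extends to a map of these sequences, and this makes $\Omega^{-1}$ a functor on the stable category. For $f\colon M\to N$ in $\mathrm{CM}(A)$ let $C(f)$ be the pushout of $f$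 and $i$, with $i'\colon N\to C(f)$ and with $p'\colon C(f)\to\Omega^{-1}(M)$ induced by $0$ on $N$ and by $p$ on $Q$; the image of $M\xrightarrow{f}N\xrightarrow{i'}C(f)\xrightarrow{-p'}\Omega^{-1}(M)$ in $\underline{\mathrm{CM}}(A)$ is a basic exact triangle, and the exact triangles are those isomorphic to a basic one. A function $\xi\colon\mathrm{ICM}(A)\to\mathbb Z$ is a pre-triangle function if, for all MCM modules: (1) $\xi(\langle M\rangle)\ge 0$; (2) $\xi(\langle M\rangle)=0$ if and only if $M$ is free; (3) $\xi(\langle M_1\oplus M_2\rangle)=\xi(\langle M_1\rangle)+\xi(\langle M_2\rangle)$; (4) $\xi(\langle N\rangle)\le\xi(\langle M\rangle)+\xi(\langle L\rangle)$ for every exact sequence $0\to M\to N\to L\to 0$ in $\mathrm{CM}(A)$. A function $\xi'\colon\underline{\mathrm{ICM}}(A)\to\mathbb Z$ is a triangle function if: (1) $\xi'([M])\ge 0$; (2) $\xi'([M])=0$ if and only if $M=0$ in $\underline{\mathrm{CM}}(A)$; (3) $\xi'([M_1\oplus M_2])=\xi'([M_1])+\xi'([M_2])$; (4) for every exact triangle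 $M\to N\to L\to\Omega^{-1}(M)$ one has $\xi'([N])\le\xi'([M])+\xi'([L])$, $\ \xi'([L])\le\xi'([N])+\xi'([\Omega^{-1}(M)])$ and $\xi'([\Omega^{-1}(M)])\le\xi'([L])+\xi'([\Omega^{-1}(N)])$. Theorem. The co-syzygy of an MCM $A$-module is again MCM, and for every pre-triangle function $\xi\colon\mathrm{ICM}(A)\to\mathbb Z$ the assignment $\xi'([M])=\xi(\langle M\rangle)$ is a well-defined function $\underline{\mathrm{ICM}}(A)\to\mathbb Z$, and it is a triangle function. -/

import Mathlib

open CategoryTheory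

universe u

namespace StableCM

section Basic

variable (A : Type u) [CommRing A]

/-- A Noetherian (local) ring is Gorenstein if it has finite injective dimension as a module over
itself. -/
def IsGorenstein : Prop :=
  injectiveDimension (ModuleCat.of A A) ≠ ⊤

variable [IsLocalRing A]

/-- Maximal Cohen-Macaulay modules: finitely generated modules that are zero, or that admit a
regular sequence of length `dim A` in the maximal ideal (that is, `depth M = dim A`). -/
def isMCM : ObjectProperty (ModuleCat.{u} A) := fun M =>
  Module.Finite A M ∧
    (Subsingleton M ∨
      ∃ rs : List A, (rs.length : WithBot ℕ∞) = ringKrullDim A ∧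
        (∀ r ∈ rs, r ∈ IsLocalRing.maximalIdeal A) ∧ RingTheory.Sequence.IsRegular M rs)

/-- The category `CM(A)` of maximal Cohen-Macaulay modules, full in the category of modules. -/
abbrev CM : Type (u + 1) := (isMCM A).FullSubcategory

instance (M : CM A) : Module.Finite A M.obj := M.property.1

/-- Isomorphism classes of maximal Cohen-Macaulay modules. -/
abbrev ICM : Type (u + 1) := _root_.Quotient (isIsomorphicSetoid (CM A))

variable {A}

/-- The isomorphism class `<M>` of `M` in `CM(A)`. -/
def ICM.mk (M : CM A) : ICM A := Quotient.mk (isIsomorphicSetoid (CM A)) M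

end Basic

section DirectSum

variable {A : Type u} [CommRing A] [IsLocalRing A] [IsNoetherianRing A]

open Abelian in
theorem isMCM_prod (M N : ModuleCat.{u} A) (hM : isMCM A M) (hN : isMCM A N) :
    isMCM A (ModuleCat.of A (M × N)) := by
  have := hM.1
  have := hN.1
  refine ⟨inferInstanceAs (Module.Finite A (M × N)), ?_⟩
  rcases hM.2 with h | ⟨rs, hl, hm, hr⟩
  · rcases hN.2 with h' | ⟨rs, hl, hm, hr⟩
    · exact Or.inl (inferInstanceAs (Subsingleton (M × N)))
    · refine Or.inr ⟨rs, hl, hm, ?_⟩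
      let e : N ≃ₗ[A] (M × N) := LinearEquiv.ofBijective (LinearMap.inr A M N)
        ⟨LinearMap.inr_injective, fun x => ⟨x.2, Prod.ext (Subsingleton.elim _ _) rfl⟩⟩
      exact (e.isRegular_congr rs).1 hr
  · rcases hN.2 with h' | ⟨rs', hl', hm', hr'⟩
    · refine Or.inr ⟨rs, hl, hm, ?_⟩
      let e : M ≃ₗ[A] (M × N) := LinearEquiv.ofBijective (LinearMap.inl A M N)
        ⟨LinearMap.inl_injective, fun x => ⟨x.1, Prod.ext rfl (Subsingleton.elim _ _)⟩⟩
      exact (e.isRegular_congr rs).1 hr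
    · have hlt : ∀ (X : ModuleCat.{u} A), Module.Finite A X → Nontrivial X →
          IsLocalRing.maximalIdeal A • (⊤ : Submodule A X) < ⊤ := fun X _ _ =>
        (Submodule.top_ne_ideal_smul_of_le_jacobson_annihilator
          (IsLocalRing.maximalIdeal_le_jacobson _)).symm.lt_top
      have hMn : Nontrivial M := hr.nontrivial
      have hNn : Nontrivial N := hr'.nontrivial
      have hll : rs'.length = rs.length := by
        have := hl'.trans hl.symm
        exact_mod_cast this
      have h1 := ((ModuleCat.exists_isRegular_tfae (IsLocalRing.maximalIdeal A) rs.length M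
        (hlt M hM.1 hMn)).out 3 1 rfl rfl).1 ⟨rs, rfl, hm, hr⟩
      have h2 := ((ModuleCat.exists_isRegular_tfae (IsLocalRing.maximalIdeal A) rs.length N
        (hlt N hN.1 hNn)).out 3 1 rfl rfl).1 ⟨rs', hll, hm', hr'⟩
      have hfin : Module.Finite A (ModuleCat.of A (M × N)) :=
        inferInstanceAs (Module.Finite A (M × N))
      obtain ⟨qs, h3, h4, h5⟩ := ((ModuleCat.exists_isRegular_tfae (IsLocalRing.maximalIdeal A)
        rs.length (ModuleCat.of A (M × N)) (hlt _ hfin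
          (inferInstanceAs (Nontrivial (M × N))))).out 3 1 rfl rfl).2 (by
        intro i hi
        have := h1 i hi
        have := h2 i hi
        refine ⟨fun x y => ?_⟩
        have key : ∀ z : Ext (ModuleCat.of A (Shrink.{u} (A ⧸ IsLocalRing.maximalIdeal A)))
            (ModuleCat.of A (M × N)) i, z = 0 := by
          intro z
          have hid : 𝟙 (ModuleCat.of A (M × N)) =
              ModuleCat.ofHom (LinearMap.fst A M N) ≫ ModuleCat.ofHom (LinearMap.inl A M N) +
              ModuleCat.ofHom (LinearMap.snd A M N) ≫ ModuleCat.ofHom (LinearMap.inr A M N) := by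
            ext x <;> simp
          have e1 : z = z.comp (Ext.mk₀ (𝟙 (ModuleCat.of A (M × N)))) (add_zero i) := by simp
          rw [e1, hid, Ext.mk₀_add, Ext.comp_add, ← Ext.mk₀_comp_mk₀, ← Ext.mk₀_comp_mk₀,
            ← Ext.comp_assoc z _ _ (add_zero i) (add_zero 0) (by simp),
            ← Ext.comp_assoc z _ _ (add_zero i) (add_zero 0) (by simp),
            Subsingleton.elim (z.comp (Ext.mk₀ (ModuleCat.ofHom (LinearMap.fst A M N)))
              (add_zero i)) 0,
            Subsingleton.elim (z.comp (Ext.mk₀ (ModuleCat.ofHom (LinearMap.snd A M N)))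
              (add_zero i)) 0]
          simp
        rw [key x, key y])
      exact Or.inr ⟨qs, by rw [h3, hl], h4, h5⟩

/-- The direct sum of two maximal Cohen-Macaulay modules. -/
def CM.sum (M N : CM A) : CM A :=
  ⟨ModuleCat.of A (M.obj × N.obj), isMCM_prod _ _ M.property N.property⟩

/-- Pre-triangle functions on isomorphism classes of maximal Cohen-Macaulay modules. -/
structure IsPreTriangleFunction (ξ : ICM A → ℤ) : Prop where
  nonneg : ∀ M : CM A, 0 ≤ ξ (ICM.mk M)
  eq_zero_iff : ∀ M : CM A, ξ (ICM.mk M) = 0 ↔ Module.Free A M.obj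
  add : ∀ M N : CM A, ξ (ICM.mk (M.sum N)) = ξ (ICM.mk M) + ξ (ICM.mk N)
  subadd : ∀ (M N L : CM A) (f : M.obj →ₗ[A] N.obj) (g : N.obj →ₗ[A] L.obj),
    Function.Injective f → Function.Exact f g → Function.Surjective g →
      ξ (ICM.mk N) ≤ ξ (ICM.mk M) + ξ (ICM.mk L)

end DirectSum

section Stable

variable (A : Type u) [CommRing A]

/-- `P(M, N)`: linear maps that factor through a finitely generated free module. -/
def FactorsThroughFree {A : Type u} [CommRing A] {M N : Type u} [AddCommGroup M] [Module A M]
    [AddCommGroup N] [Module A N] (f : M →ₗ[A] N) : Prop :=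
  ∃ (n : ℕ) (g : M →ₗ[A] (Fin n → A)) (h : (Fin n → A) →ₗ[A] N), h ∘ₗ g = f

theorem factorsThroughFree_zero {A : Type u} [CommRing A] {M N : Type u} [AddCommGroup M]
    [Module A M] [AddCommGroup N] [Module A N] : FactorsThroughFree (0 : M →ₗ[A] N) :=
  ⟨0, 0, 0, by simp⟩

theorem FactorsThroughFree.add {A : Type u} [CommRing A] {M N : Type u} [AddCommGroup M]
    [Module A M] [AddCommGroup N] [Module A N] {f g : M →ₗ[A] N} (hf : FactorsThroughFree f)
    (hg : FactorsThroughFree g) : FactorsThroughFree (f + g) := by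
  obtain ⟨n, a, b, rfl⟩ := hf
  obtain ⟨m, c, d, rfl⟩ := hg
  let e : (Fin (n + m) → A) ≃ₗ[A] (Fin n → A) × (Fin m → A) :=
    (LinearEquiv.funCongrLeft A A finSumFinEquiv).trans
      (LinearEquiv.sumArrowLequivProdArrow (Fin n) (Fin m) A A)
  refine ⟨n + m, e.symm.toLinearMap ∘ₗ a.prod c, (b.coprod d) ∘ₗ e.toLinearMap, ?_⟩
  ext x
  simp

variable [IsLocalRing A]

/-- Two morphisms of `CM(A)` are identified if their difference lies in `P(M, N)`. -/
def stableRel : HomRel (CM A) := fun _ _ f g => FactorsThroughFree (f.hom.hom - g.hom.hom)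

/-- The relation is a congruence, so that morphisms of the quotient category by it are exactly the
classes modulo `P(M, N)`. -/
instance : Congruence (stableRel A) where
  equivalence :=
    { refl := fun f => by
        rw [stableRel, sub_self]
        exact factorsThroughFree_zero
      symm := fun {f g} h => by
        obtain ⟨n, a, b, h⟩ := h
        exact ⟨n, a, -b, by rw [LinearMap.neg_comp, h, neg_sub]⟩
      trans := fun {f g k} h h' => by
        have := FactorsThroughFree.add h h'
        rwa [sub_add_sub_cancel] at this }
  comp_left := by
    intro _ _ _ f g g' h
    obtain ⟨n, a, b, h⟩ := h
    exact ⟨n, a ∘ₗ f.hom.hom, b, by rw [← LinearMap.comp_assoc, h]; rfl⟩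
  comp_right := by
    intro _ _ _ f f' g h
    obtain ⟨n, a, b, h⟩ := h
    refine ⟨n, a, g.hom.hom ∘ₗ b, ?_⟩
    rw [LinearMap.comp_assoc, h, LinearMap.comp_sub]
    rfl

/-- The stable category of maximal Cohen-Macaulay modules: the objects of `CM(A)`, with
`Hom(M, N) / P(M, N)` as morphisms from `M` to `N`. -/
abbrev Stable : Type (u + 1) := CategoryTheory.Quotient (stableRel A)

/-- The projection `CM(A) ⥤ Stable(A)`. -/
abbrev proj : CM A ⥤ Stable A := CategoryTheory.Quotient.functor (stableRel A)

/-- Isomorphism classes in the stable category. -/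
abbrev StableICM : Type (u + 1) := _root_.Quotient (isIsomorphicSetoid (Stable A))

variable {A}

/-- The isomorphism class `[M]` of `M` in the stable category. -/
def StableICM.mk (M : Stable A) : StableICM A := Quotient.mk (isIsomorphicSetoid (Stable A)) M

end Stable

section Cosyzygy

variable (A : Type u) [CommRing A] [IsNoetherianRing A]
variable (M : Type u) [AddCommGroup M] [Module A M] [Module.Finite A M]

/-- `μ(M*)`, the minimal number of generators of the dual of `M`. -/
noncomputable def dualRank : ℕ := (⊤ : Submodule A (Module.Dual A M)).spanFinrank

theorem exists_dualGens : ∃ ε : Fin (dualRank A M) → Module.Dual A M,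
    Submodule.span A (Set.range ε) = ⊤ := by
  obtain ⟨s, hs, hspan⟩ := Submodule.FG.exists_span_finset_card_eq_spanFinrank
    (Module.Finite.fg_top (R := A) (M := Module.Dual A M))
  refine ⟨fun i => (s.equivFinOfCardEq hs).symm i, ?_⟩
  have h : Set.range (fun i => (((s.equivFinOfCardEq hs).symm i : s) : Module.Dual A M)) = s := by
    ext x
    constructor
    · rintro ⟨i, rfl⟩
      exact ((s.equivFinOfCardEq hs).symm i).2
    · intro hx
      exact ⟨s.equivFinOfCardEq hs ⟨x, hx⟩, by simp⟩
  exact (congrArg (Submodule.span A) h).trans hspan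

/-- A minimal system of generators of `M*`, i.e. a minimal surjection `ε : A^n → M*`. -/
noncomputable def dualGens : Fin (dualRank A M) → Module.Dual A M :=
  (exists_dualGens A M).choose

/-- The map `M → M** → (A^n)* = A^n` dual to the minimal surjection `ε : A^n → M*`. -/
noncomputable def cosyzygyIn : M →ₗ[A] (Fin (dualRank A M) → A) :=
  LinearMap.pi (dualGens A M)

/-- The co-syzygy `Ω⁻¹(M)`, the cokernel of `M → A^n`. -/
abbrev Cosyzygy : Type u := (Fin (dualRank A M) → A) ⧸ LinearMap.range (cosyzygyIn A M)

/-- The projection `A^n → Ω⁻¹(M)`. -/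
noncomputable def cosyzygyOut : (Fin (dualRank A M) → A) →ₗ[A] Cosyzygy A M :=
  Submodule.mkQ _

variable {A M}

/-- Every map from `M` to a finitely generated free module extends along `M → A^n`. -/
theorem exists_extend {n : ℕ} (g : M →ₗ[A] (Fin n → A)) :
    ∃ b : (Fin (dualRank A M) → A) →ₗ[A] (Fin n → A), b ∘ₗ cosyzygyIn A M = g := by
  have h1 : ∀ φ : Module.Dual A M, ∃ β : (Fin (dualRank A M) → A) →ₗ[A] A,
      β ∘ₗ cosyzygyIn A M = φ := by
    intro φ
    have hφ : φ ∈ Submodule.span A (Set.range (dualGens A M)) := by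
      rw [dualGens, (exists_dualGens A M).choose_spec]
      trivial
    induction hφ using Submodule.span_induction with
    | mem x hx =>
      obtain ⟨i, rfl⟩ := hx
      exact ⟨LinearMap.proj i, rfl⟩
    | zero => exact ⟨0, by simp⟩
    | add x y _ _ hx hy =>
      obtain ⟨a, rfl⟩ := hx
      obtain ⟨b, rfl⟩ := hy
      exact ⟨a + b, LinearMap.add_comp _ _ _⟩
    | smul r x _ hx =>
      obtain ⟨a, rfl⟩ := hx
      exact ⟨r • a, LinearMap.smul_comp _ _ _⟩
  choose β hβ using fun i => h1 (LinearMap.proj i ∘ₗ g)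
  refine ⟨LinearMap.pi β, ?_⟩
  ext m i
  exact LinearMap.congr_fun (hβ i) m

variable {N : Type u} [AddCommGroup N] [Module A N] [Module.Finite A N]

/-- `c : Ω⁻¹(M) → Ω⁻¹(N)` is induced by `f : M → N` if it completes `f` to a morphism of the
sequences `M → A^m → Ω⁻¹(M)` and `N → A^n → Ω⁻¹(N)`. -/
def IsInduced (f : M →ₗ[A] N) (c : Cosyzygy A M →ₗ[A] Cosyzygy A N) : Prop :=
  ∃ b : (Fin (dualRank A M) → A) →ₗ[A] (Fin (dualRank A N) → A),
    b ∘ₗ cosyzygyIn A M = cosyzygyIn A N ∘ₗ f ∧ c ∘ₗ cosyzygyOut A M = cosyzygyOut A N ∘ₗ b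

theorem exists_isInduced (f : M →ₗ[A] N) : ∃ c, IsInduced f c := by
  obtain ⟨b, hb⟩ := exists_extend (cosyzygyIn A N ∘ₗ f)
  refine ⟨Submodule.mapQ _ _ b ?_, b, hb, LinearMap.ext fun _ => rfl⟩
  rintro _ ⟨m, rfl⟩
  exact ⟨f m, (LinearMap.congr_fun hb m).symm⟩

theorem factors_of_isInduced {f f' : M →ₗ[A] N} {c c' : Cosyzygy A M →ₗ[A] Cosyzygy A N}
    (h : IsInduced f c) (h' : IsInduced f' c') (hf : FactorsThroughFree (f - f')) :
    FactorsThroughFree (c - c') := by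
  obtain ⟨b, hb, hc⟩ := h
  obtain ⟨b', hb', hc'⟩ := h'
  obtain ⟨n, g, k, hgk⟩ := hf
  obtain ⟨e, he⟩ := exists_extend g
  let t := b - b' - cosyzygyIn A N ∘ₗ k ∘ₗ e
  have ht : LinearMap.range (cosyzygyIn A M) ≤ LinearMap.ker t := by
    rintro _ ⟨m, rfl⟩
    have h1 := LinearMap.congr_fun hb m
    have h2 := LinearMap.congr_fun hb' m
    have h3 := LinearMap.congr_fun he m
    have h4 := LinearMap.congr_fun hgk m
    simp only [LinearMap.comp_apply, LinearMap.sub_apply] at h1 h2 h3 h4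
    simp [t, h1, h2, h3, h4]
  refine ⟨dualRank A N, Submodule.liftQ _ t ht, cosyzygyOut A N, ?_⟩
  refine Submodule.linearMap_qext _ ?_
  ext1 i
  have h1 := LinearMap.congr_fun hc
  have h2 := LinearMap.congr_fun hc'
  ext
  have h3 : ∀ x, cosyzygyOut A N (cosyzygyIn A N x) = 0 := fun x =>
    (Submodule.Quotient.mk_eq_zero _).2 ⟨x, rfl⟩
  simp only [LinearMap.comp_apply, cosyzygyOut, Submodule.mkQ_apply] at h1 h2 h3
  simp [t, h1, h2, h3, cosyzygyOut]

/-- A chosen map `Ω⁻¹(M) → Ω⁻¹(N)` induced by `f`; its stable class does not depend on the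
choice. -/
noncomputable def cosyzygyMap (f : M →ₗ[A] N) : Cosyzygy A M →ₗ[A] Cosyzygy A N :=
  (exists_isInduced f).choose

theorem cosyzygyMap_isInduced (f : M →ₗ[A] N) : IsInduced f (cosyzygyMap f) :=
  (exists_isInduced f).choose_spec

end Cosyzygy

section Triangles

variable (A : Type u) [CommRing A] [IsLocalRing A] [IsNoetherianRing A]

/-- Co-syzygies of maximal Cohen-Macaulay modules are maximal Cohen-Macaulay. -/
def CosyzygyClosed : Prop :=
  ∀ M : CM A, isMCM A (ModuleCat.of A (Cosyzygy A M.obj))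

variable {A}

/-- `Ω⁻¹(M)` as an object of `CM(A)`. -/
noncomputable def CosyzygyClosed.obj (hΩ : CosyzygyClosed A) (M : CM A) : CM A :=
  ⟨ModuleCat.of A (Cosyzygy A M.obj), hΩ M⟩

/-- A map induced on co-syzygies by a morphism of `CM(A)`. -/
noncomputable def CosyzygyClosed.map (hΩ : CosyzygyClosed A) {M N : CM A} (f : M ⟶ N) :
    hΩ.obj M ⟶ hΩ.obj N :=
  ObjectProperty.homMk (ModuleCat.ofHom (cosyzygyMap f.hom.hom))

theorem CosyzygyClosed.proj_map_eq (hΩ : CosyzygyClosed A) {M N : CM A} (f g : M ⟶ N)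
    (c : hΩ.obj M ⟶ hΩ.obj N) (hc : IsInduced g.hom.hom c.hom.hom)
    (hfg : FactorsThroughFree (f.hom.hom - g.hom.hom)) :
    (proj A).map (hΩ.map f) = (proj A).map c :=
  CategoryTheory.Quotient.sound _
    (factors_of_isInduced (cosyzygyMap_isInduced f.hom.hom) hc hfg)

/-- The translation functor `Ω⁻¹` of the stable category. -/
noncomputable def translation (hΩ : CosyzygyClosed A) : Stable A ⥤ Stable A :=
  CategoryTheory.Quotient.lift (stableRel A)
    { obj := fun M => (proj A).obj (hΩ.obj M)
      map := fun f => (proj A).map (hΩ.map f)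
      map_id := fun M => by
        rw [← (proj A).map_id]
        refine hΩ.proj_map_eq _ (𝟙 M) _ ⟨LinearMap.id, rfl, rfl⟩ ?_
        rw [sub_self]
        exact factorsThroughFree_zero
      map_comp := fun {M N L} f g => by
        rw [← (proj A).map_comp]
        refine hΩ.proj_map_eq _ (f ≫ g) _ ?_ ?_
        · obtain ⟨b, hb, hc⟩ := cosyzygyMap_isInduced f.hom.hom
          obtain ⟨b', hb', hc'⟩ := cosyzygyMap_isInduced g.hom.hom
          refine ⟨b' ∘ₗ b, ?_, ?_⟩
          · change (b' ∘ₗ b) ∘ₗ _ = cosyzygyIn A L.obj ∘ₗ (g.hom.hom ∘ₗ f.hom.hom)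
            rw [LinearMap.comp_assoc, hb, ← LinearMap.comp_assoc, hb', LinearMap.comp_assoc]
          · change (cosyzygyMap g.hom.hom ∘ₗ cosyzygyMap f.hom.hom) ∘ₗ _ = _
            rw [LinearMap.comp_assoc, hc, ← LinearMap.comp_assoc, hc', LinearMap.comp_assoc]
        · rw [sub_self]
          exact factorsThroughFree_zero }
    (fun _ _ f g h => hΩ.proj_map_eq f g _ (cosyzygyMap_isInduced g.hom.hom) h)

/-- Sequences `M ⟶ N ⟶ L ⟶ Ω⁻¹(M)` in the stable category. -/
structure Triangle (hΩ : CosyzygyClosed A) where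
  /-- the first object -/
  M : Stable A
  /-- the second object -/
  N : Stable A
  /-- the third object -/
  L : Stable A
  /-- the first morphism -/
  f : M ⟶ N
  /-- the second morphism -/
  g : N ⟶ L
  /-- the third morphism -/
  h : L ⟶ (translation hΩ).obj M

/-- Isomorphism of triangles. -/
def Triangle.Isomorphic {hΩ : CosyzygyClosed A} (S T : Triangle hΩ) : Prop :=
  ∃ (a : S.M ≅ T.M) (b : S.N ≅ T.N) (c : S.L ≅ T.L),
    S.f ≫ b.hom = a.hom ≫ T.f ∧ S.g ≫ c.hom = b.hom ≫ T.g ∧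
      S.h ≫ (translation hΩ).map a.hom = c.hom ≫ T.h

/-- Basic exact triangles: `C` is the pushout of `f : M → N` and `i : M → Q = A^n`, the map
`p' : C → Ω⁻¹(M)` is `0` on `N` and the projection `p : Q → Ω⁻¹(M)` on `Q`, and the triangle is
the image of `M → N → C → Ω⁻¹(M)` with maps `f`, `i'`, `-p'`. -/
def Triangle.IsBasic {hΩ : CosyzygyClosed A} (T : Triangle hΩ) : Prop :=
  ∃ (M N C : CM A) (f : M ⟶ N) (i' : N ⟶ C) (p' : C ⟶ hΩ.obj M)
    (q : ModuleCat.of A (Fin (dualRank A M.obj) → A) ⟶ C.obj),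
    IsPushout f.hom (ModuleCat.ofHom (cosyzygyIn A M.obj)) i'.hom q ∧
    i'.hom ≫ p'.hom = 0 ∧
    q ≫ p'.hom = ModuleCat.ofHom (cosyzygyOut A M.obj) ∧
    T = { M := (proj A).obj M, N := (proj A).obj N, L := (proj A).obj C,
          f := (proj A).map f, g := (proj A).map i',
          h := (proj A).map (ObjectProperty.homMk (-p'.hom)) }

/-- Exact triangles are the triangles isomorphic to a basic one. -/
def Triangle.IsExact {hΩ : CosyzygyClosed A} (T : Triangle hΩ) : Prop :=
  ∃ S : Triangle hΩ, S.IsBasic ∧ T.Isomorphic S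

/-- Triangle functions on isomorphism classes of the stable category. -/
structure IsTriangleFunction (hΩ : CosyzygyClosed A) (ξ : StableICM A → ℤ) : Prop where
  nonneg : ∀ M : Stable A, 0 ≤ ξ (StableICM.mk M)
  eq_zero_iff : ∀ M : Stable A, ξ (StableICM.mk M) = 0 ↔ Limits.IsZero M
  add : ∀ M N : CM A, ξ (StableICM.mk ((proj A).obj (M.sum N))) =
    ξ (StableICM.mk ((proj A).obj M)) + ξ (StableICM.mk ((proj A).obj N))
  subadd₁ : ∀ T : Triangle hΩ, T.IsExact →
    ξ (StableICM.mk T.N) ≤ ξ (StableICM.mk T.M) + ξ (StableICM.mk T.L)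
  subadd₂ : ∀ T : Triangle hΩ, T.IsExact →
    ξ (StableICM.mk T.L) ≤
      ξ (StableICM.mk T.N) + ξ (StableICM.mk ((translation hΩ).obj T.M))
  subadd₃ : ∀ T : Triangle hΩ, T.IsExact →
    ξ (StableICM.mk ((translation hΩ).obj T.M)) ≤
      ξ (StableICM.mk T.L) + ξ (StableICM.mk ((translation hΩ).obj T.N))

end Triangles

end StableCM

/-! Two facts about a Gorenstein local ring carry the theorem: the map `M → Aⁿ` given by generators
of `M*` is injective with MCM cokernel, and a stable isomorphism is an isomorphism up to finite free
summands.

For the first, take a maximal regular sequence `rs` of `A`, so that the residue field `k` embeds in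
`A/(rs)`. Finite injective dimension forces `Ext^i(N, A) = 0` for finite `N` and `i > rs.length`
(`subsingleton_ext_of_length_lt`). Dimension shifting then makes `A/(rs)` injective with respect to
finite modules killed by `rs`, and the copy of `k` makes it a cogenerator for them
(`exists_map_ne_zero`). The resulting double annihilator property shows that the maximal ideal is
nilpotent modulo `rs`; hence `rs.length = dim A`, and `A` is Cohen-Macaulay. If `M` is MCM, then
`Ext^i(M, A) = 0` for `i > 0`, so maps `M → A/(rs)` lift to `A` and thus extend along `M → Aⁿ`. They
separate the points of `M/(rs)M`, so `M → Aⁿ` is injective modulo `rs`. By Nakayama it is then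
injective, with `rs` weakly regular on the cokernel (`cosyzygyIn_injective_and_isMCM`).

For the second, stably inverse maps yield `N ⊕ Aⁿ ≅ M ⊕ K` with `K` finite free
(`exists_equiv_prod_free`). As `ξ` is additive and vanishes on free modules, it descends to stable
classes.

The triangle inequalities are subadditivity of `ξ` on three exact sequences attached to the pushout
`C` of `N ← M → Q`: `0 → M → N ⊕ Q → C → 0`, `0 → N → C → Ω⁻¹M → 0` and `0 → C → Ω⁻¹M ⊕ Aⁿ → Ω⁻¹N →
0`. -/

namespace StableCM

open Abelian IsLocalRing RingTheory.Sequence Module Pointwise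

/-! ### Vanishing of `Ext` into a ring of finite injective dimension -/

section ExtVanishing

variable {A : Type u} [CommRing A]

/-- The short complex of a pair of composable linear maps that is exact in the middle. -/
abbrev shortComplexOfExact {M N L : Type u} [AddCommGroup M] [Module A M] [AddCommGroup N]
    [Module A N] [AddCommGroup L] [Module A L] (f : M →ₗ[A] N) (g : N →ₗ[A] L)
    (h : Function.Exact f g) : ShortComplex (ModuleCat.{u} A) :=
  ModuleCat.shortComplexOfCompEqZero f g h.linearMap_comp_eq_zero

theorem shortExact_of_exact {M N L : Type u} [AddCommGroup M] [Module A M] [AddCommGroup N]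
    [Module A N] [AddCommGroup L] [Module A L] {f : M →ₗ[A] N} {g : N →ₗ[A] L}
    (hf : Function.Injective f) (h : Function.Exact f g) (hg : Function.Surjective g) :
    (shortComplexOfExact f g h).ShortExact where
  exact := ModuleCat.shortComplex_exact _ h
  mono_f := (ModuleCat.mono_iff_injective _).2 hf
  epi_g := (ModuleCat.epi_iff_surjective _).2 hg

theorem subsingleton_ext_of_iso {M N Y : ModuleCat.{u} A} (e : M ≅ N) (i : ℕ)
    [Subsingleton (Ext N Y i)] : Subsingleton (Ext M Y i) := by
  refine subsingleton_of_forall_eq 0 fun z => ?_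
  have h1 : z = (Ext.mk₀ e.hom).comp ((Ext.mk₀ e.inv).comp z (zero_add i)) (zero_add i) := by
    rw [← Ext.comp_assoc (Ext.mk₀ e.hom) (Ext.mk₀ e.inv) z (zero_add 0) (zero_add i)
      (by simp), Ext.mk₀_comp_mk₀, e.hom_inv_id, Ext.mk₀_id_comp]
  rw [h1, Subsingleton.elim ((Ext.mk₀ e.inv).comp z (zero_add i)) 0, Ext.comp_zero]

theorem subsingleton_ext_of_shortExact₂ {S : ShortComplex (ModuleCat.{u} A)} (hS : S.ShortExact)
    {Y : ModuleCat.{u} A} {i : ℕ} (h₁ : Subsingleton (Ext S.X₁ Y i))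
    (h₃ : Subsingleton (Ext S.X₃ Y i)) : Subsingleton (Ext S.X₂ Y i) := by
  refine subsingleton_of_forall_eq 0 fun z => ?_
  obtain ⟨w, rfl⟩ := Ext.contravariant_sequence_exact₂ hS Y z (Subsingleton.elim _ _)
  rw [Subsingleton.elim w 0, Ext.comp_zero]

theorem subsingleton_ext_of_shortExact₁ {S : ShortComplex (ModuleCat.{u} A)} (hS : S.ShortExact)
    {Y : ModuleCat.{u} A} {i : ℕ} (h₂ : Subsingleton (Ext S.X₂ Y i))
    (h₃ : Subsingleton (Ext S.X₃ Y (i + 1))) : Subsingleton (Ext S.X₁ Y i) := by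
  refine subsingleton_of_forall_eq 0 fun z => ?_
  obtain ⟨w, rfl⟩ := Ext.contravariant_sequence_exact₁ hS Y z (add_comm 1 i)
    (Subsingleton.elim _ _)
  rw [Subsingleton.elim w 0, Ext.comp_zero]

theorem surjective_precomp_of_shortExact {S : ShortComplex (ModuleCat.{u} A)} (hS : S.ShortExact)
    {Y : ModuleCat.{u} A} {i : ℕ} (h₃ : Subsingleton (Ext S.X₃ Y (i + 1))) (z : Ext S.X₁ Y i) :
    ∃ w : Ext S.X₂ Y i, (Ext.mk₀ S.f).comp w (zero_add i) = z :=
  Ext.contravariant_sequence_exact₁ hS Y z (add_comm 1 i) (Subsingleton.elim _ _)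

/-- Multiplication by `r` on either argument induces the same map on `Ext`, and on `N` it is zero.
-/
theorem comp_smul_id_eq_zero {N Y : ModuleCat.{u} A} {r : A}
    (hr : r ∈ Module.annihilator A N) {i : ℕ} (w : Ext N Y i) :
    w.comp (Ext.mk₀ (r • 𝟙 Y)) (add_zero i) = 0 := by
  have h0 : r • 𝟙 N = 0 := by
    ext x
    exact Module.mem_annihilator.1 hr x
  rw [Ext.mk₀_smul, Ext.comp_smul, Ext.comp_mk₀_id, ← Ext.mk₀_id_comp w, ← Ext.smul_comp,
    ← Ext.mk₀_smul, h0, Ext.mk₀_zero, Ext.zero_comp]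

/-- A diagram chase: extend the boundary of `z` to a class `w` on `N`. By `hzero`, `w` is itself a
boundary, of some `v`. The restriction of `v` differs from `z` by a class coming from `Ext N' S.X₂
i`, which is zero. -/
theorem surjective_precomp_of_covariant {S : ShortComplex (ModuleCat.{u} A)} (hS : S.ShortExact)
    {N' N : ModuleCat.{u} A} (g : N' ⟶ N) {i : ℕ}
    (hzero : ∀ w : Ext N S.X₁ (i + 1), w.comp (Ext.mk₀ S.f) (add_zero _) = 0)
    (hvan : Subsingleton (Ext N' S.X₂ i))
    (hext : ∀ z : Ext N' S.X₁ (i + 1), ∃ w : Ext N S.X₁ (i + 1),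
      (Ext.mk₀ g).comp w (zero_add _) = z) (z : Ext N' S.X₃ i) :
    ∃ w : Ext N S.X₃ i, (Ext.mk₀ g).comp w (zero_add _) = z := by
  obtain ⟨w, hw⟩ := hext (z.comp hS.extClass rfl)
  obtain ⟨v, hv⟩ := Ext.covariant_sequence_exact₁ N hS w (hzero w) rfl
  have hd : (((Ext.mk₀ g).comp v (zero_add _)) + -z).comp hS.extClass rfl = 0 := by
    rw [Ext.add_comp, Ext.neg_comp, Ext.comp_assoc (Ext.mk₀ g) v hS.extClass (zero_add i) rfl
      (by omega), hv, hw,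
      add_neg_cancel]
  obtain ⟨y, hy⟩ := Ext.covariant_sequence_exact₃ N' hS _ rfl hd
  rw [Subsingleton.elim y 0, Ext.zero_comp] at hy
  exact ⟨v, add_neg_eq_zero.1 hy.symm⟩

/-- Dimension shifting: for modules killed by a regular sequence `rs` on `Y`, morphisms into
`Y/(rs)` extend along a monomorphism if classes of degree `rs.length` into `Y` do. -/
theorem exists_extension_of_ext [IsNoetherianRing A] (rs : List A) (Y : ModuleCat.{u} A)
    [Module.Finite A Y] (hrs : IsRegular Y rs) {N' N : ModuleCat.{u} A} [Module.Finite A N] [Module.Finite A N']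
    (g : N' ⟶ N) (hN : Ideal.ofList rs ≤ Module.annihilator A N)
    (hN' : Ideal.ofList rs ≤ Module.annihilator A N')
    (hext : ∀ z : Ext N' Y rs.length, ∃ w : Ext N Y rs.length,
      (Ext.mk₀ g).comp w (zero_add _) = z)
    (φ : N' →ₗ[A] Y ⧸ (Ideal.ofList rs • ⊤ : Submodule A Y)) :
    ∃ ψ : N →ₗ[A] Y ⧸ (Ideal.ofList rs • ⊤ : Submodule A Y), ψ ∘ₗ g.hom = φ := by
  induction rs generalizing Y with
  | nil =>
    have e0 : (Ideal.ofList ([] : List A) • ⊤ : Submodule A Y) = ⊥ := by simp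
    let e := Submodule.quotEquivOfEqBot _ e0
    obtain ⟨w, hw⟩ := hext (Ext.mk₀ (ModuleCat.ofHom (e.toLinearMap ∘ₗ φ)))
    obtain ⟨w, rfl⟩ := (Ext.mk₀_bijective _ _).2 w
    have hw' : (Ext.mk₀ g).comp (Ext.mk₀ w) (zero_add 0) =
      Ext.mk₀ (ModuleCat.ofHom (e.toLinearMap ∘ₗ φ)) := hw
    rw [Ext.mk₀_comp_mk₀, (Ext.mk₀_bijective _ _).1.eq_iff] at hw'
    refine ⟨e.symm.toLinearMap ∘ₗ w.hom, ?_⟩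
    ext x
    have := LinearMap.congr_fun (congrArg ModuleCat.Hom.hom hw') x
    simp at this
    simp [this]
  | cons r rs ih =>
    -- `N'` is supported on the zero locus of `r :: rs`, a `Y`-regular sequence one longer than the
    -- degree considered.
    have hvan : Subsingleton (Ext N' Y rs.length) := by
      refine ModuleCat.subsingleton_ext_of_exists_isRegular (Ideal.ofList (r :: rs)) N' ?_ Y
        hrs.2.symm.lt_top (r :: rs) (fun x hx => Ideal.subset_span hx) hrs _ (by simp)
      rw [Module.support_eq_zeroLocus]
      exact PrimeSpectrum.zeroLocus_anti_mono_ideal hN'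
    have hr : r ∈ Ideal.ofList (r :: rs) := Ideal.subset_span (by simp)
    have hle : Ideal.ofList rs ≤ Ideal.ofList (r :: rs) := by simp
    rw [isRegular_cons_iff] at hrs
    have hS := hrs.1.smulShortComplex_shortExact
    have key := ih (ModuleCat.of A (QuotSMulTop r Y)) hrs.2 (hle.trans hN) (hle.trans hN')
      (surjective_precomp_of_covariant (S := ModuleCat.smulShortComplex Y r) hS g
        (fun w => comp_smul_id_eq_zero (hN hr) w) hvan hext)
    let e₀ := Submodule.quotOfListConsSMulTopEquivQuotSMulTopInner Y r rs
    obtain ⟨ψ, hψ⟩ := key (e₀.toLinearMap ∘ₗ φ)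
    refine ⟨e₀.symm.toLinearMap ∘ₗ ψ, ?_⟩
    rw [LinearMap.comp_assoc, hψ, ← LinearMap.comp_assoc]
    simp

variable [IsLocalRing A] [IsNoetherianRing A]

/-- By Nakayama's lemma, `Ext^i(M, N)` vanishes if `Ext^{i+1}(M/xM, N)` does. -/
theorem subsingleton_ext_of_quotSMulTop {M N : ModuleCat.{u} A} [Module.Finite A M]
    [Module.Finite A N] {x : A} (hx : x ∈ maximalIdeal A) (reg : IsSMulRegular M x) (i : ℕ)
    (h : Subsingleton (Ext (ModuleCat.of A (QuotSMulTop x M)) N (i + 1))) :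
    Subsingleton (Ext M N i) := by
  by_contra ntr
  rw [not_subsingleton_iff_nontrivial] at ntr
  have hj : x ∈ (Module.annihilator A (Ext M N i)).jacobson :=
    IsLocalRing.maximalIdeal_le_jacobson _ hx
  refine Submodule.top_ne_pointwise_smul_of_mem_jacobson_annihilator hj ?_
  rw [eq_comm, eq_top_iff]
  intro y _
  -- The next term of the long exact sequence vanishes, so multiplication by `x` is onto on
  -- `Ext^i(M, N)`.
  obtain ⟨z, hz⟩ := surjective_precomp_of_shortExact reg.smulShortComplex_shortExact h y
  have hz' : (Ext.mk₀ (x • 𝟙 M)).comp (show Ext M N i from z) (zero_add i) = y := hz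
  rw [Ext.mk₀_smul, Ext.smul_comp, Ext.mk₀_id_comp] at hz'
  rw [← hz']
  exact Submodule.smul_mem_pointwise_smul _ _ ⊤ trivial

/-- A ring of finite injective dimension over itself: `Ext` groups of finite modules into the ring
vanish above the length of a maximal regular sequence. -/
theorem subsingleton_ext_of_length_lt {n : ℕ} [HasInjectiveDimensionLT (ModuleCat.of A A) n]
    {rs : List A} (hrs : IsRegular A rs)
    (hass : ∃ s : A ⧸ Ideal.ofList rs,
      maximalIdeal A = LinearMap.ker (LinearMap.toSpanSingleton A _ s)) :
    ∀ i, rs.length < i → ∀ N : ModuleCat.{u} A, Module.Finite A N →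
      Subsingleton (Ext N (ModuleCat.of A A) i) := by
  -- Descending induction on the degree: `j` bounds how far `i` lies below `n`, where vanishing is
  -- given.
  suffices H : ∀ j i, rs.length < i → n ≤ i + j → ∀ N : ModuleCat.{u} A, Module.Finite A N →
      Subsingleton (Ext N (ModuleCat.of A A) i) from
    fun i hi => H n i hi (Nat.le_add_left n i)
  intro j
  induction j with
  | zero => exact fun i _ hn N _ => HasInjectiveDimensionLT.subsingleton _ n i hn N
  | succ j ih =>
    intro i hi hn
    have ih' := ih (i + 1) (by omega) (by omega)
    obtain ⟨s, hs⟩ := hass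
    have hpd : Subsingleton (Ext (ModuleCat.of A (A ⧸ Ideal.ofList rs)) (ModuleCat.of A A) i) := by
      have h := ModuleCat.projectiveDimension_quotient_eq_length rs hrs
      rw [projectiveDimension_eq_of_iso (Shrink.linearEquiv A (A ⧸ Ideal.ofList rs)).toModuleIso]
        at h
      have : HasProjectiveDimensionLT (ModuleCat.of A (A ⧸ Ideal.ofList rs)) i := by
        rw [← projectiveDimension_lt_iff, h]
        exact_mod_cast hi
      exact HasProjectiveDimensionLT.subsingleton _ i i le_rfl _
    -- The residue field sits inside `A/(rs)`, whose projective dimension `rs.length` is less than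
    -- `i`; the cokernel contributes only degree `i + 1`.
    have hk : Subsingleton (Ext (ModuleCat.of A (A ⧸ maximalIdeal A)) (ModuleCat.of A A) i) := by
      let ι : (A ⧸ maximalIdeal A) →ₗ[A] (A ⧸ Ideal.ofList rs) :=
        Submodule.liftQ _ (LinearMap.toSpanSingleton A _ s) hs.le
      have hι : Function.Injective ι :=
        LinearMap.ker_eq_bot.1 (Submodule.ker_liftQ_eq_bot _ _ _ hs.ge)
      have hS := shortExact_of_exact hι (LinearMap.exact_map_mkQ_range ι)
        (Submodule.mkQ_surjective _)
      exact subsingleton_ext_of_shortExact₁ hS hpd (ih' _ (by dsimp; infer_instance))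
    suffices H : ∀ (N : Type u) [AddCommGroup N] [Module A N] (_ : Module.Finite A N),
        Subsingleton (Ext (ModuleCat.of A N) (ModuleCat.of A A) i) from fun N hN => H N hN
    intro N _ _ hN
    induction hN using IsNoetherianRing.induction_on_isQuotientEquivQuotientPrime A with
    | subsingleton N =>
      refine subsingleton_of_forall_eq 0 fun z => ?_
      have h0 : (𝟙 (ModuleCat.of A N)) = 0 := by
        ext x
        exact Subsingleton.elim (α := N) _ _
      rw [← Ext.mk₀_id_comp z, h0, Ext.mk₀_zero, Ext.zero_comp]
    | quotient N p e =>
      refine @subsingleton_ext_of_iso _ _ _ _ _ e.toModuleIso i ?_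
      by_cases hp : p.1 = maximalIdeal A
      · rw [hp]
        exact hk
      -- For a nonmaximal prime, an element of the maximal ideal outside `p` is regular on `A/p`, so
      -- Nakayama reduces to degree `i + 1`.
      · obtain ⟨x, hxm, hxp⟩ := Set.not_subset.1 fun h =>
          hp (le_antisymm (IsLocalRing.le_maximalIdeal p.2.ne_top) h)
        refine subsingleton_ext_of_quotSMulTop hxm ?_ i (ih' _ (by dsimp; infer_instance))
        intro a b hab
        obtain ⟨a, rfl⟩ := Ideal.Quotient.mk_surjective a
        obtain ⟨b, rfl⟩ := Ideal.Quotient.mk_surjective b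
        have hab' : Ideal.Quotient.mk p.1 (x * a) = Ideal.Quotient.mk p.1 (x * b) := hab
        rw [Ideal.Quotient.eq, ← mul_sub] at hab'
        exact Ideal.Quotient.eq.2 ((p.2.mem_or_mem hab').resolve_left hxp)
    | exact N₁ N₂ N₃ f g hf hg hfg h₁ h₃ =>
      exact subsingleton_ext_of_shortExact₂ (shortExact_of_exact hf hfg hg) h₁ h₃

end ExtVanishing
end StableCM

namespace StableCM

open Abelian IsLocalRing RingTheory.Sequence Module Pointwise

/-! ### Gorenstein rings are Cohen-Macaulay -/

section Gorenstein

variable {A : Type u} [CommRing A] [IsLocalRing A]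

theorem mem_maximalIdeal_of_isRegular {rs : List A} (h : IsRegular A rs) :
    ∀ r ∈ rs, r ∈ maximalIdeal A := by
  intro r hr
  refine IsLocalRing.le_maximalIdeal h.2.symm ?_
  rw [smul_eq_mul, Ideal.mul_top]
  exact Ideal.subset_span hr

variable [IsNoetherianRing A]

theorem length_le_of_isRegular {rs : List A} (h : IsRegular A rs) :
    (rs.length : WithBot ℕ∞) ≤ ringKrullDim A := by
  rw [← ringKrullDim_add_length_eq_ringKrullDim_of_isRegular rs h]
  have : Nontrivial (A ⧸ Ideal.ofList rs) := by
    have h2 := h.2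
    rw [smul_eq_mul, Ideal.mul_top] at h2
    exact Ideal.Quotient.nontrivial_iff.2 h2.symm
  exact le_add_of_nonneg_left ringKrullDim_nonneg_of_nontrivial

/-- The residue field embeds into the quotient by a regular sequence of maximal length. -/
theorem exists_socle_of_maximal {rs : List A} (h : IsRegular A rs)
    (hmax : ∀ qs : List A, IsRegular A qs → qs.length ≤ rs.length) :
    ∃ s : A ⧸ Ideal.ofList rs,
      maximalIdeal A = LinearMap.ker (LinearMap.toSpanSingleton A _ s) := by
  by_cases hs : Subsingleton ((A ⧸ maximalIdeal A) →ₗ[A] (A ⧸ Ideal.ofList rs))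
  -- If `Hom(k, A/(rs)) = 0`, the maximal ideal contains an element regular on `A/(rs)`, so `rs`
  -- could be prolonged.
  · obtain ⟨r, hr, hreg⟩ := IsSMulRegular.subsingleton_linearMap_iff.1 hs
    rw [Ideal.annihilator_quotient] at hr
    have e0 : (Ideal.ofList rs • ⊤ : Submodule A A) = Ideal.ofList rs := by
      rw [smul_eq_mul, Ideal.mul_top]
    have h1 : IsWeaklyRegular A (rs ++ [r]) := by
      rw [isWeaklyRegular_append_iff, isWeaklyRegular_singleton_iff]
      refine ⟨h.1, ?_⟩
      rw [e0]
      exact hreg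
    have h2 := hmax _ (IsRegular.of_isWeaklyRegular_of_mem_maximalIdeal A (fun x hx => by
      rcases List.mem_append.1 hx with hx | hx
      · exact mem_maximalIdeal_of_isRegular h x hx
      · rw [List.mem_singleton.1 hx]
        exact hr) h1)
    simp at h2
  · rw [not_subsingleton_iff_nontrivial] at hs
    obtain ⟨φ, hφ⟩ := exists_ne (0 : (A ⧸ maximalIdeal A) →ₗ[A] (A ⧸ Ideal.ofList rs))
    refine ⟨φ (Ideal.Quotient.mk _ 1), ((maximalIdeal.isMaximal A).eq_of_le ?_ ?_)⟩
    · intro htop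
      refine hφ (LinearMap.ext fun x => ?_)
      obtain ⟨a, rfl⟩ := Ideal.Quotient.mk_surjective x
      have ha : a ∈ LinearMap.ker (LinearMap.toSpanSingleton A _ (φ (Ideal.Quotient.mk _ 1))) := by
        rw [htop]
        trivial
      rw [LinearMap.mem_ker, LinearMap.toSpanSingleton_apply, ← map_smul] at ha
      rw [LinearMap.zero_apply, ← ha]
      congr 1
      rw [← Ideal.Quotient.mk_eq_mk, ← Ideal.Quotient.mk_eq_mk, ← Submodule.Quotient.mk_smul,
        smul_eq_mul, mul_one]
    · intro a ha
      rw [LinearMap.mem_ker, LinearMap.toSpanSingleton_apply, ← map_smul]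
      have : a • Ideal.Quotient.mk (maximalIdeal A) 1 = 0 := by
        rw [← Ideal.Quotient.mk_eq_mk, ← Submodule.Quotient.mk_smul, smul_eq_mul, mul_one]
        exact Ideal.Quotient.eq_zero_iff_mem.2 ha
      rw [this, map_zero]

theorem exists_isRegular_maximal : ∃ rs : List A, IsRegular A rs ∧
    ∀ qs : List A, IsRegular A qs → qs.length ≤ rs.length := by
  obtain ⟨d, hd⟩ : ∃ d : ℕ, ringKrullDim A ≤ d := by
    have h := ringKrullDim_lt_top (R := A)
    generalize ringKrullDim A = x at h
    induction x with
    | bot => exact ⟨0, bot_le⟩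
    | coe x =>
      induction x with
      | top => exact absurd h (lt_irrefl _)
      | coe x => exact ⟨x, le_rfl⟩
  have hb : BddAbove {n | ∃ rs : List A, IsRegular A rs ∧ rs.length = n} := by
    refine ⟨d, ?_⟩
    rintro n ⟨rs, hrs, rfl⟩
    exact_mod_cast (length_le_of_isRegular hrs).trans hd
  obtain ⟨rs, hrs, hl⟩ := Nat.sSup_mem (s := {n | ∃ rs : List A, IsRegular A rs ∧ rs.length = n})
    ⟨0, [], IsRegular.nil A A, rfl⟩ hb
  exact ⟨rs, hrs, fun qs hqs => hl ▸ le_csSup hb ⟨qs, hqs, rfl⟩⟩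

variable {rs : List A} (hA : IsGorenstein A) (hrs : IsRegular A rs)
  (hass : ∃ s : A ⧸ Ideal.ofList rs,
    maximalIdeal A = LinearMap.ker (LinearMap.toSpanSingleton A _ s))

include hA hrs hass

theorem subsingleton_ext_of_isGorenstein (i : ℕ) (hi : rs.length < i) (N : ModuleCat.{u} A)
    [Module.Finite A N] : Subsingleton (Ext N (ModuleCat.of A A) i) := by
  obtain ⟨n, hn⟩ := (injectiveDimension_ne_top_iff _).1 hA
  exact subsingleton_ext_of_length_lt (n := n + 1) hrs hass i hi N inferInstance

/-- The quotient by a maximal regular sequence is self-injective with respect to finite modules. -/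
theorem exists_extension {N' N : Type u} [AddCommGroup N'] [Module A N'] [AddCommGroup N]
    [Module A N] [Module.Finite A N] (hN : Ideal.ofList rs ≤ Module.annihilator A N)
    {g : N' →ₗ[A] N} (hg : Function.Injective g) (φ : N' →ₗ[A] A ⧸ Ideal.ofList rs) :
    ∃ ψ : N →ₗ[A] A ⧸ Ideal.ofList rs, ψ ∘ₗ g = φ := by
  have : Module.Finite A N' := Module.Finite.of_injective g hg
  have e0 : (Ideal.ofList rs • ⊤ : Submodule A A) = Ideal.ofList rs := by
    rw [smul_eq_mul, Ideal.mul_top]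
  let e := Submodule.quotEquivOfEq _ _ e0
  have hS := shortExact_of_exact hg (LinearMap.exact_map_mkQ_range g) (Submodule.mkQ_surjective _)
  obtain ⟨ψ, hψ⟩ := exists_extension_of_ext rs (ModuleCat.of A A) hrs (ModuleCat.ofHom g) hN
    (hN.trans (LinearMap.annihilator_le_of_injective g hg))
    (surjective_precomp_of_shortExact hS
      (@subsingleton_ext_of_isGorenstein _ _ _ _ _ hA hrs hass _ (Nat.lt_succ_self _) _
        (by dsimp; infer_instance)))
    (e.symm.toLinearMap ∘ₗ φ)
  refine ⟨e.toLinearMap ∘ₗ ψ, ?_⟩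
  have hψ' : ψ ∘ₗ g = e.symm.toLinearMap ∘ₗ φ := hψ
  rw [LinearMap.comp_assoc, hψ']
  ext x
  simp

/-- The quotient by a maximal regular sequence is a cogenerator for finite modules. -/
theorem exists_map_ne_zero {N : Type u} [AddCommGroup N]
    [Module A N] [Module.Finite A N] (hN : Ideal.ofList rs ≤ Module.annihilator A N) {z : N}
    (hz : z ≠ 0) : ∃ ψ : N →ₗ[A] A ⧸ Ideal.ofList rs, ψ z ≠ 0 := by
  obtain ⟨s, hs⟩ := id hass
  -- The cyclic module `Az ≅ A/ann(z)` maps to `A/(rs)` by sending its generator to the socle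
  -- element `s`, since `ann(z)` lies in the maximal ideal. This map is extended to `N`.
  let f := LinearMap.toSpanSingleton A N z
  have hf : LinearMap.ker f ≤ maximalIdeal A := by
    refine IsLocalRing.le_maximalIdeal fun h => hz ?_
    have : (1 : A) ∈ LinearMap.ker f := h ▸ trivial
    simpa [f] using this
  let g : (A ⧸ LinearMap.ker f) →ₗ[A] N := Submodule.liftQ _ f le_rfl
  have hg : Function.Injective g := LinearMap.ker_eq_bot.1 (Submodule.ker_liftQ_eq_bot _ _ _ le_rfl)
  obtain ⟨ψ, hψ⟩ := exists_extension hA hrs hass hN hg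
    (Submodule.liftQ _ (LinearMap.toSpanSingleton A _ s) (hf.trans hs.le))
  refine ⟨ψ, fun h0 => ?_⟩
  have h1 := LinearMap.congr_fun hψ (Submodule.Quotient.mk 1)
  have h2 : s = 0 := by
    rw [LinearMap.comp_apply, Submodule.liftQ_apply, Submodule.liftQ_apply] at h1
    simpa [f, h0] using h1.symm
  refine (maximalIdeal.isMaximal A).ne_top ?_
  rw [hs, h2, eq_top_iff]
  intro x _
  simp

/-- If `x ∉ J`, the cogenerator property gives a map `A/J → A/(rs)` not killing `x`. It is
multiplication by some `b`; then `bJ ⊆ (rs)` while `xb ∉ (rs)`. -/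
theorem colon_colon_le {J : Ideal A} (hJ : Ideal.ofList rs ≤ J) :
    (Ideal.ofList rs).colon ((Ideal.ofList rs).colon (J : Set A) : Set A) ≤ J := by
  intro x hx
  by_contra hxJ
  obtain ⟨ψ, hψ⟩ := exists_map_ne_zero hA hrs hass (N := A ⧸ J)
    (by rwa [Ideal.annihilator_quotient]) (z := Ideal.Quotient.mk J x)
    (fun h => hxJ (Ideal.Quotient.eq_zero_iff_mem.1 h))
  obtain ⟨b, hb⟩ := Ideal.Quotient.mk_surjective (ψ (Ideal.Quotient.mk J 1))
  have hmul : ∀ y : A, ψ (Ideal.Quotient.mk J y) = Ideal.Quotient.mk (Ideal.ofList rs) (y * b) := by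
    intro y
    have h1 : Ideal.Quotient.mk J y = y • Ideal.Quotient.mk J 1 := by
      rw [← Ideal.Quotient.mk_eq_mk, ← Ideal.Quotient.mk_eq_mk, ← Submodule.Quotient.mk_smul,
        smul_eq_mul, mul_one]
    rw [h1, map_smul, ← hb]
    rfl
  refine hψ ?_
  rw [hmul, Ideal.Quotient.eq_zero_iff_mem]
  refine Submodule.mem_colon.1 hx b (Submodule.mem_colon.2 fun y hy => ?_)
  rw [smul_eq_mul, mul_comm, ← Ideal.Quotient.eq_zero_iff_mem, ← hmul,
    Ideal.Quotient.eq_zero_iff_mem.2 hy, map_zero]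

/-- The maximal ideal is nilpotent modulo a maximal regular sequence. -/
theorem exists_pow_maximalIdeal_le : ∃ n : ℕ, maximalIdeal A ^ n ≤ Ideal.ofList rs := by
  let J : ℕ → Ideal A := fun n => maximalIdeal A ^ n ⊔ Ideal.ofList rs
  have hJ : Antitone J := fun m n h => sup_le_sup_right (Ideal.pow_le_pow_right h) _
  let K : ℕ →o Ideal A :=
    ⟨fun n => (Ideal.ofList rs).colon (J n : Set A), fun m n h x hx =>
      Submodule.mem_colon.2 fun y hy => Submodule.mem_colon.1 hx y (hJ h hy)⟩
  obtain ⟨n, hn⟩ := monotone_stabilizes_iff_noetherian.2 (inferInstanceAs (IsNoetherian A A)) K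
  refine ⟨n, ?_⟩
  -- The ideals `(rs) : J n` ascend and stabilize; the double annihilator property transfers this
  -- back to the descending chain `J n`.
  have h1 : J n ≤ J (n + 1) := by
    refine le_trans ?_ (colon_colon_le hA hrs hass (J := J (n + 1)) le_sup_right)
    have h2 : (Ideal.ofList rs).colon (J n : Set A) =
      (Ideal.ofList rs).colon (J (n + 1) : Set A) := hn (n + 1) (Nat.le_succ n)
    rw [← h2]
    intro x hx
    refine Submodule.mem_colon.2 fun y hy => ?_
    rw [smul_eq_mul, mul_comm]
    exact Submodule.mem_colon.1 hy x hx
  -- Nakayama, from `𝔪ⁿ ⊆ (rs) + 𝔪 · 𝔪ⁿ`.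
  refine Submodule.le_of_le_smul_of_le_jacobson_bot (I := maximalIdeal A)
    (IsNoetherian.noetherian _) (IsLocalRing.maximalIdeal_le_jacobson _) ?_
  refine (le_sup_left.trans h1).trans ?_
  rw [sup_comm, smul_eq_mul, ← pow_succ']

/-- The maximal ideal is nilpotent in `A/(rs)`, so every prime there is maximal and the quotient has
dimension zero. -/
theorem ringKrullDim_eq_length : (rs.length : WithBot ℕ∞) = ringKrullDim A := by
  refine le_antisymm (length_le_of_isRegular hrs) ?_
  rw [← ringKrullDim_add_length_eq_ringKrullDim_of_isRegular rs hrs]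
  obtain ⟨n, hn⟩ := exists_pow_maximalIdeal_le hA hrs hass
  have h0 : ringKrullDim (A ⧸ Ideal.ofList rs) ≤ (0 : ℕ) := by
    rw [← Ring.krullDimLE_iff, Ring.krullDimLE_zero_iff]
    intro p hp
    have hle : maximalIdeal A ≤ p.comap (Ideal.Quotient.mk (Ideal.ofList rs)) := by
      refine Ideal.IsPrime.le_of_pow_le (hP := Ideal.IsPrime.comap _) (n := n) (hn.trans ?_)
      intro x hx
      rw [Ideal.mem_comap, Ideal.Quotient.eq_zero_iff_mem.2 hx]
      exact p.zero_mem
    have hmax : (p.comap (Ideal.Quotient.mk (Ideal.ofList rs))).IsMaximal := by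
      rw [← (maximalIdeal.isMaximal A).eq_of_le (Ideal.IsPrime.comap _).ne_top hle]
      exact maximalIdeal.isMaximal A
    have hmap := Ideal.map_comap_of_surjective _ Ideal.Quotient.mk_surjective p
    rw [← hmap]
    exact (Ideal.map_eq_top_or_isMaximal_of_surjective _ Ideal.Quotient.mk_surjective
      hmax).resolve_left fun h => hp.ne_top (hmap.symm.trans h)
  calc _ ≤ ((0 : ℕ) : WithBot ℕ∞) + rs.length := by gcongr
    _ = _ := by simp

end Gorenstein
end StableCM

namespace StableCM

open Abelian IsLocalRing RingTheory.Sequence Module Pointwise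

/-! ### Co-syzygies of MCM modules -/

section MaximalCohenMacaulay

variable {A : Type u} [CommRing A]

theorem subsingleton_ext_of_covariant {S : ShortComplex (ModuleCat.{u} A)} (hS : S.ShortExact)
    {M : ModuleCat.{u} A} {i : ℕ} (h₂ : Subsingleton (Ext M S.X₂ i))
    (h₁ : Subsingleton (Ext M S.X₁ (i + 1))) : Subsingleton (Ext M S.X₃ i) := by
  refine subsingleton_of_forall_eq 0 fun z => ?_
  obtain ⟨w, rfl⟩ := Ext.covariant_sequence_exact₃ M hS z rfl (Subsingleton.elim _ _)
  rw [Subsingleton.elim w 0, Ext.zero_comp]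

theorem exists_lift_of_shortExact {S : ShortComplex (ModuleCat.{u} A)} (hS : S.ShortExact)
    {M : ModuleCat.{u} A} (h₁ : Subsingleton (Ext M S.X₁ 1)) (φ : M ⟶ S.X₃) :
    ∃ ψ : M ⟶ S.X₂, ψ ≫ S.g = φ := by
  obtain ⟨w, hw⟩ := Ext.covariant_sequence_exact₃ M hS (Ext.mk₀ φ) (zero_add 1)
    (Subsingleton.elim _ _)
  obtain ⟨w, rfl⟩ := (Ext.mk₀_bijective _ _).2 w
  rw [Ext.mk₀_comp_mk₀, (Ext.mk₀_bijective _ _).1.eq_iff] at hw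
  exact ⟨w, hw⟩

/-- A retraction survives reduction modulo `r`. Used to pass weak regularity from `A ⊕ M` to each
summand. -/
theorem isWeaklyRegular_of_leftInverse (rs : List A) {M N : Type u} [AddCommGroup M] [Module A M]
    [AddCommGroup N] [Module A N] (i : M →ₗ[A] N) (p : N →ₗ[A] M) (h : p ∘ₗ i = LinearMap.id)
    (hN : IsWeaklyRegular N rs) : IsWeaklyRegular M rs := by
  induction rs generalizing M N with
  | nil => exact IsWeaklyRegular.nil _ _
  | cons r rs ih =>
    rw [isWeaklyRegular_cons_iff] at hN ⊢
    refine ⟨hN.1.of_injective i ?_, ih (QuotSMulTop.map r i) (QuotSMulTop.map r p) ?_ hN.2⟩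
    · exact Function.LeftInverse.injective (g := p) (LinearMap.congr_fun h)
    · rw [← QuotSMulTop.map_comp, h, QuotSMulTop.map_id]

/-- If the higher `Ext` groups of `M` into `Y` vanish, then every map from `M` to the quotient of
`Y` by a weakly regular sequence lifts to `Y`. -/
theorem exists_lift_of_isWeaklyRegular (rs : List A) (Y M : ModuleCat.{u} A)
    (hrs : IsWeaklyRegular Y rs) (h : ∀ i, 0 < i → Subsingleton (Ext M Y i))
    (φ : M →ₗ[A] Y ⧸ (Ideal.ofList rs • ⊤ : Submodule A Y)) :
    ∃ ψ : M →ₗ[A] Y, Submodule.mkQ _ ∘ₗ ψ = φ := by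
  induction rs generalizing Y with
  | nil =>
    have e0 : (Ideal.ofList ([] : List A) • ⊤ : Submodule A Y) = ⊥ := by simp
    let e := Submodule.quotEquivOfEqBot _ e0
    refine ⟨e.toLinearMap ∘ₗ φ, LinearMap.ext fun x => e.injective ?_⟩
    simp [e]
  | cons r rs ih =>
    rw [isWeaklyRegular_cons_iff] at hrs
    let e := Submodule.quotOfListConsSMulTopEquivQuotSMulTopInner Y r rs
    have hS := hrs.1.smulShortComplex_shortExact
    obtain ⟨ψ, hψ⟩ := ih (ModuleCat.of A (QuotSMulTop r Y)) hrs.2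
      (fun i hi => subsingleton_ext_of_covariant hS (h i hi) (h (i + 1) (Nat.succ_pos i)))
      (e.toLinearMap ∘ₗ φ)
    obtain ⟨w, hw⟩ := exists_lift_of_shortExact hS (h 1 one_pos) (ModuleCat.ofHom ψ)
    refine ⟨w.hom, LinearMap.ext fun x => e.injective ?_⟩
    have h1 := LinearMap.congr_fun hψ x
    have h2 : Submodule.mkQ _ (w.hom x) = ψ x :=
      LinearMap.congr_fun (congrArg ModuleCat.Hom.hom hw) x
    refine Eq.trans ?_ h1
    rw [LinearMap.comp_apply, ← h2]
    rfl

theorem mkQ_mem_ofList_smul_top_iff {M : Type u} [AddCommGroup M] [Module A M] (r : A)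
    (rs : List A) (m : M) :
    (Submodule.Quotient.mk m : QuotSMulTop r M) ∈ (Ideal.ofList rs • ⊤ : Submodule A _) ↔
      m ∈ (Ideal.ofList (r :: rs) • ⊤ : Submodule A M) := by
  have h := Submodule.comap_smul_top_of_surjective (Ideal.ofList rs)
    (Submodule.mkQ (r • (⊤ : Submodule A M))) (Submodule.mkQ_surjective _)
  rw [Submodule.ker_mkQ] at h
  rw [Ideal.ofList_cons_smul, sup_comm, ← h]
  rfl

/-- If `M → Q` becomes injective modulo a sequence in the maximal ideal that is weakly regular on
`Q`, then it is injective and the sequence is weakly regular on the cokernel. -/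
theorem injective_and_isWeaklyRegular_of_exact [IsLocalRing A] [IsNoetherianRing A] (rs : List A)
    (hmem : ∀ r ∈ rs, r ∈ maximalIdeal A) {M Q C : Type u} [AddCommGroup M] [Module A M]
    [AddCommGroup Q] [Module A Q] [AddCommGroup C] [Module A C] [Module.Finite A M]
    (hQ : IsWeaklyRegular Q rs) {f : M →ₗ[A] Q} {g : Q →ₗ[A] C} (hfg : Function.Exact f g)
    (hg : Function.Surjective g)
    (hf : ∀ m, f m ∈ (Ideal.ofList rs • ⊤ : Submodule A Q) →
      m ∈ (Ideal.ofList rs • ⊤ : Submodule A M)) :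
    Function.Injective f ∧ IsWeaklyRegular C rs := by
  induction rs generalizing M Q C with
  | nil =>
    refine ⟨(injective_iff_map_eq_zero f).2 fun m hm => ?_, IsWeaklyRegular.nil _ _⟩
    simpa [hm] using hf m
  | cons r rs ih =>
    rw [isWeaklyRegular_cons_iff] at hQ ⊢
    obtain ⟨h1, h2⟩ := ih (fun x hx => hmem x (List.mem_cons_of_mem _ hx)) hQ.2
      (QuotSMulTop.map_exact r hfg hg) (QuotSMulTop.map_surjective r hg) (by
        intro m hm
        obtain ⟨m, rfl⟩ := Submodule.Quotient.mk_surjective _ m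
        rw [mkQ_mem_ofList_smul_top_iff]
        exact hf m ((mkQ_mem_ofList_smul_top_iff r rs (f m)).1 hm))
    -- Injectivity modulo `r` shows that `m` is divisible by `r`, and `r` cancels on `Q`. The case
    -- `q = 0` gives `ker f = r · ker f`; the general case gives regularity of `r` on `C`.
    have key : ∀ m q, f m = r • q → ∃ m', m = r • m' ∧ f m' = q := by
      intro m q hmq
      have h3 : (Submodule.Quotient.mk m : QuotSMulTop r M) = 0 := by
        refine (injective_iff_map_eq_zero _).1 h1 _ ?_
        change (Submodule.Quotient.mk (f m) : QuotSMulTop r Q) = 0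
        rw [Submodule.Quotient.mk_eq_zero, hmq]
        exact Submodule.smul_mem_pointwise_smul _ _ _ trivial
      rw [Submodule.Quotient.mk_eq_zero] at h3
      obtain ⟨m', -, rfl⟩ := (Submodule.mem_smul_pointwise_iff_exists _ _ _).1 h3
      refine ⟨m', rfl, hQ.1 ?_⟩
      change r • f m' = r • q
      rw [← hmq, map_smul]
    refine ⟨LinearMap.ker_eq_bot.1 (Submodule.eq_bot_of_le_smul_of_le_jacobson_bot
      (maximalIdeal A) _ (IsNoetherian.noetherian _) ?_
      (IsLocalRing.maximalIdeal_le_jacobson _)), ?_, h2⟩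
    · intro m hm
      obtain ⟨m', rfl, hm'⟩ := key m 0 (by rw [smul_zero]; exact hm)
      exact Submodule.smul_mem_smul (hmem r (by simp)) hm'
    · refine isSMulRegular_iff_right_eq_zero_of_smul.2 fun c hc => ?_
      obtain ⟨q, rfl⟩ := hg c
      rw [← map_smul] at hc
      obtain ⟨m, hm⟩ := (hfg _).1 hc
      obtain ⟨m', -, rfl⟩ := key m q hm
      exact hfg.apply_apply_eq_zero m'

theorem isMCM_of_equiv [IsLocalRing A] {M N : Type u} [AddCommGroup M] [Module A M]
    [AddCommGroup N] [Module A N] (e : M ≃ₗ[A] N) (h : isMCM A (ModuleCat.of A M)) :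
    isMCM A (ModuleCat.of A N) := by
  have := h.1
  refine ⟨Module.Finite.equiv (M := M) e, ?_⟩
  rcases h.2 with h | ⟨rs, hl, hm, hr⟩
  · exact Or.inl (e.symm.toEquiv.subsingleton_congr.2 h)
  · exact Or.inr ⟨rs, hl, hm, (e.isRegular_congr rs).1 hr⟩

theorem cosyzygy_exact [IsNoetherianRing A] (M : Type u) [AddCommGroup M] [Module A M]
    [Module.Finite A M] : Function.Exact (cosyzygyIn A M) (cosyzygyOut A M) :=
  LinearMap.exact_map_mkQ_range _

theorem cosyzygyOut_surjective [IsNoetherianRing A] (M : Type u) [AddCommGroup M] [Module A M]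
    [Module.Finite A M] : Function.Surjective (cosyzygyOut A M) :=
  Submodule.mkQ_surjective _

variable [IsLocalRing A] [IsNoetherianRing A]

/-- Killing one regular element raises the degree to be checked by one, by the Nakayama argument. -/
theorem subsingleton_ext_of_isWeaklyRegular {Y : ModuleCat.{u} A} [Module.Finite A Y]
    (rs : List A) (hmem : ∀ r ∈ rs, r ∈ maximalIdeal A) (M : ModuleCat.{u} A) [Module.Finite A M]
    (hrs : IsWeaklyRegular M rs) (i : ℕ)
    (h : ∀ N : ModuleCat.{u} A, Module.Finite A N → Subsingleton (Ext N Y (i + rs.length))) :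
    Subsingleton (Ext M Y i) := by
  induction rs generalizing M i with
  | nil => exact h M inferInstance
  | cons r rs ih =>
    rw [isWeaklyRegular_cons_iff] at hrs
    refine subsingleton_ext_of_quotSMulTop (hmem r (by simp)) hrs.1 i ?_
    refine @ih (fun x hx => hmem x (List.mem_cons_of_mem _ hx)) _ (by dsimp; infer_instance)
      hrs.2 (i + 1) ?_
    rwa [add_assoc, add_comm 1, ← List.length_cons]

theorem exists_socle_of_length_eq {rs : List A} (h : IsRegular A rs)
    (hl : (rs.length : WithBot ℕ∞) = ringKrullDim A) :
    ∃ s : A ⧸ Ideal.ofList rs,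
      maximalIdeal A = LinearMap.ker (LinearMap.toSpanSingleton A _ s) :=
  exists_socle_of_maximal h fun qs hqs => by
    have := length_le_of_isRegular hqs
    rw [← hl] at this
    exact_mod_cast this

theorem isMCM_self (hA : IsGorenstein A) : isMCM A (ModuleCat.of A A) := by
  obtain ⟨rs, hrs, hmax⟩ := exists_isRegular_maximal (A := A)
  exact ⟨inferInstanceAs (Module.Finite A A), Or.inr ⟨rs,
    ringKrullDim_eq_length hA hrs (exists_socle_of_maximal hrs hmax),
    mem_maximalIdeal_of_isRegular hrs, hrs⟩⟩

theorem isMCM_pi (hA : IsGorenstein A) (n : ℕ) : isMCM A (ModuleCat.of A (Fin n → A)) := by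
  induction n with
  | zero => exact ⟨inferInstanceAs (Module.Finite A (Fin 0 → A)),
      Or.inl (inferInstanceAs (Subsingleton (Fin 0 → A)))⟩
  | succ n ih =>
    exact isMCM_of_equiv (Fin.consLinearEquiv A (fun _ => A)) (isMCM_prod _ _ (isMCM_self hA) ih)

theorem isMCM_of_free (hA : IsGorenstein A) (F : Type u) [AddCommGroup F] [Module A F]
    [Module.Finite A F] [Module.Free A F] : isMCM A (ModuleCat.of A F) :=
  isMCM_of_equiv (Module.finBasis A F).equivFun.symm (isMCM_pi hA _)

/-- Over a Gorenstein ring, a maximal Cohen-Macaulay module embeds into a free module with maximal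
Cohen-Macaulay cokernel. -/
theorem cosyzygyIn_injective_and_isMCM (hA : IsGorenstein A) (M : Type u) [AddCommGroup M]
    [Module A M] [Module.Finite A M] (hM : isMCM A (ModuleCat.of A M)) :
    Function.Injective (cosyzygyIn A M) ∧ isMCM A (ModuleCat.of A (Cosyzygy A M)) := by
  -- Passing to `A ⊕ M` yields one sequence of length `dim A` that works for `A` and `M` at once,
  -- and also covers `M = 0`.
  obtain ⟨hfin, h | ⟨rs, hl, hm, hr⟩⟩ := isMCM_prod _ _ (isMCM_self hA) hM
  · exact absurd (h.elim ((1 : A), (0 : M)) ((0 : A), (0 : M))) (by simp)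
  have hrA : IsWeaklyRegular A rs := isWeaklyRegular_of_leftInverse rs (LinearMap.inl A A M)
    (LinearMap.fst A A M) (LinearMap.fst_comp_inl _ _ _) hr.1
  have hrM : IsWeaklyRegular M rs := isWeaklyRegular_of_leftInverse rs (LinearMap.inr A A M)
    (LinearMap.snd A A M) (LinearMap.snd_comp_inr _ _ _) hr.1
  have hrQ : IsWeaklyRegular (Fin (dualRank A M) → A) rs :=
    ((TensorProduct.rid A _).isWeaklyRegular_congr rs).1 hrA.isWeaklyRegular_lTensor
  have hrA' : IsRegular A rs := IsRegular.of_isWeaklyRegular_of_mem_maximalIdeal A hm hrA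
  have hs := exists_socle_of_length_eq hrA' hl
  have hext : ∀ i, 0 < i → Subsingleton (Ext (ModuleCat.of A M) (ModuleCat.of A A) i) := by
    intro i hi
    have : Module.Finite A (ModuleCat.of A M) := ‹Module.Finite A M›
    refine subsingleton_ext_of_isWeaklyRegular rs hm (ModuleCat.of A M) hrM i fun N _ => ?_
    exact subsingleton_ext_of_isGorenstein hA hrA' hs _ (by omega) N
  have e0 : (Ideal.ofList rs • ⊤ : Submodule A A) = Ideal.ofList rs := by
    rw [smul_eq_mul, Ideal.mul_top]
  let e := Submodule.quotEquivOfEq _ _ e0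
  obtain ⟨h1, h2⟩ := injective_and_isWeaklyRegular_of_exact rs hm hrQ (cosyzygy_exact M)
    (cosyzygyOut_surjective M) (by
      intro m hm
      by_contra hm'
      obtain ⟨ψ, hψ⟩ := exists_map_ne_zero hA hrA' hs
        (N := M ⧸ (Ideal.ofList rs • ⊤ : Submodule A M)) (by
          intro a ha
          refine Module.mem_annihilator.2 fun x => ?_
          obtain ⟨x, rfl⟩ := Submodule.Quotient.mk_surjective _ x
          rw [← Submodule.Quotient.mk_smul, Submodule.Quotient.mk_eq_zero]
          exact Submodule.smul_mem_smul ha trivial)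
        (z := Submodule.Quotient.mk m) (fun h => hm' ((Submodule.Quotient.mk_eq_zero _).1 h))
      obtain ⟨φ, hφ⟩ := exists_lift_of_isWeaklyRegular rs (ModuleCat.of A A) (ModuleCat.of A M)
        hrA hext (e.symm.toLinearMap ∘ₗ ψ ∘ₗ Submodule.mkQ _)
      obtain ⟨b, hb⟩ := exists_extend (LinearMap.pi (fun _ : Fin 1 => φ))
      have h3 : φ m ∈ (Ideal.ofList rs • ⊤ : Submodule A A) := by
        have h4 := congrFun (LinearMap.congr_fun hb m) 0
        change _ = φ m at h4
        rw [← h4]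
        -- `φ` factors through `Aⁿ`, and a linear form on `Aⁿ` sends `(rs)Aⁿ` into `(rs)`. So `φ m ∈
        -- (rs)`, contradicting the choice of `ψ`.
        exact Submodule.smul_top_le_comap_smul_top _ (LinearMap.proj 0 ∘ₗ b) hm
      refine hψ (e.symm.injective ?_)
      have h5 := LinearMap.congr_fun hφ m
      rw [map_zero]
      refine Eq.trans h5.symm ?_
      exact (Submodule.Quotient.mk_eq_zero _).2 h3)
  refine ⟨h1, Module.Finite.of_surjective _ (cosyzygyOut_surjective M), ?_⟩
  rcases subsingleton_or_nontrivial (Cosyzygy A M) with h | h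
  · exact Or.inl h
  · exact Or.inr ⟨rs, hl, hm, IsRegular.of_isWeaklyRegular_of_mem_maximalIdeal _ hm h2⟩

end MaximalCohenMacaulay
end StableCM

namespace StableCM

open IsLocalRing Module

/-! ### Stable isomorphism is isomorphism up to free summands -/

section StableEquivalence

variable {A : Type u} [CommRing A] {M N L : Type u} [AddCommGroup M] [Module A M]
  [AddCommGroup N] [Module A N] [AddCommGroup L] [Module A L]

theorem FactorsThroughFree.comp_left {f : M →ₗ[A] N} (hf : FactorsThroughFree f)
    (g : N →ₗ[A] L) : FactorsThroughFree (g ∘ₗ f) := by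
  obtain ⟨n, a, b, rfl⟩ := hf
  exact ⟨n, a, g ∘ₗ b, rfl⟩

theorem FactorsThroughFree.comp_right {g : N →ₗ[A] L} (hg : FactorsThroughFree g)
    (f : M →ₗ[A] N) : FactorsThroughFree (g ∘ₗ f) := by
  obtain ⟨n, a, b, rfl⟩ := hg
  exact ⟨n, a ∘ₗ f, b, rfl⟩

theorem factorsThroughFree_id_of_free [Module.Finite A M] [Module.Free A M] [Nontrivial A] :
    FactorsThroughFree (LinearMap.id : M →ₗ[A] M) :=
  ⟨_, (Module.finBasis A M).equivFun.toLinearMap, (Module.finBasis A M).equivFun.symm.toLinearMap,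
    by ext; simp⟩

/-- Such an `M` is a direct summand of some `Aⁿ`, hence projective, hence free over the local ring.
-/
theorem free_of_factorsThroughFree_id [IsLocalRing A] [Module.Finite A M]
    (h : FactorsThroughFree (LinearMap.id : M →ₗ[A] M)) : Module.Free A M := by
  obtain ⟨n, a, b, h⟩ := h
  have : Module.Projective A M := Module.Projective.of_split a b h
  have : Module.FinitePresentation A M := Module.finitePresentation_of_projective A M
  exact Module.free_of_flat_of_isLocalRing

/-- Stably inverse maps become an isomorphism after adding finite free modules. -/
theorem exists_equiv_prod_free [IsLocalRing A] [IsNoetherianRing A] [Module.Finite A N]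
    {f : M →ₗ[A] N} {g : N →ₗ[A] M}
    (hgf : FactorsThroughFree (LinearMap.id - g ∘ₗ f))
    (hfg : FactorsThroughFree (LinearMap.id - f ∘ₗ g)) :
    ∃ (n : ℕ) (K : Submodule A (N × (Fin n → A))), Module.Free A K ∧
      Nonempty ((N × (Fin n → A)) ≃ₗ[A] (M × K)) := by
  obtain ⟨n, a, b, hab⟩ := hgf
  -- With `id - gf = ba`, the map `s = (f, a)` is split by `r = (g, b)`, and `ker r` is the required
  -- complement.
  let s : M →ₗ[A] N × (Fin n → A) := f.prod a
  let r : N × (Fin n → A) →ₗ[A] M := g.coprod b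
  have hrs : ∀ m, r (s m) = m := by
    intro m
    have := LinearMap.congr_fun hab m
    simp only [LinearMap.comp_apply, LinearMap.sub_apply, LinearMap.id_apply] at this
    simp [r, s, this]
  let π : N × (Fin n → A) →ₗ[A] LinearMap.ker r :=
    (LinearMap.id - s ∘ₗ r).codRestrict _ (fun x => by simp [hrs])
  have hfree : FactorsThroughFree (LinearMap.id - s ∘ₗ r) := by
    -- The block `N → N` is `id - fg`; all other contributions visibly pass through `Aⁿ`. On `ker r`
    -- the projector `id - sr` is the identity.
    have h1 : LinearMap.id - s ∘ₗ r =
        LinearMap.inl A N (Fin n → A) ∘ₗ ((LinearMap.id - f ∘ₗ g) ∘ₗ LinearMap.fst A N _) +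
        ((LinearMap.inr A N _ - s ∘ₗ b) ∘ₗ LinearMap.snd A N _ +
          (-LinearMap.inr A N _) ∘ₗ (a ∘ₗ g ∘ₗ LinearMap.fst A N _)) := by
      refine LinearMap.ext fun x => Prod.ext ?_ ?_
      · simp [s, r]
        abel
      · simp [s, r]
        abel
    rw [h1]
    exact ((hfg.comp_right _).comp_left _).add
      (FactorsThroughFree.add ⟨n, _, _, rfl⟩ ⟨n, _, _, rfl⟩)
  refine ⟨n, LinearMap.ker r, free_of_factorsThroughFree_id ?_, ⟨LinearEquiv.ofLinearMap
    (r.prod π) (s.coprod (LinearMap.ker r).subtype) ?_ ?_⟩⟩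
  · have h2 : (LinearMap.id : LinearMap.ker r →ₗ[A] LinearMap.ker r) =
        π ∘ₗ (LinearMap.id - s ∘ₗ r) ∘ₗ (LinearMap.ker r).subtype := by
      refine LinearMap.ext fun k => Subtype.ext ?_
      have hk : r k = 0 := k.2
      simp [π, hk]
    rw [h2]
    exact (hfree.comp_right _).comp_left _
  · refine LinearMap.ext fun x => Prod.ext ?_ (Subtype.ext ?_)
    · have hk : r x.2 = 0 := x.2.2
      simp [hrs, hk]
    · have hk : r x.2 = 0 := x.2.2
      simp [π, hrs, hk]
  · refine LinearMap.ext fun x => ?_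
    simp [π]

end StableEquivalence

/-! ### Stable invariance of pre-triangle functions -/

section Invariance

variable {A : Type u} [CommRing A] [IsLocalRing A]

theorem ICM.mk_eq_of_equiv {M N : CM A} (e : M.obj ≃ₗ[A] N.obj) : ICM.mk M = ICM.mk N :=
  Quotient.sound ⟨(isMCM A).fullyFaithfulι.preimageIso e.toModuleIso⟩

theorem StableICM.mk_eq_of_iso {M N : Stable A} (e : M ≅ N) : StableICM.mk M = StableICM.mk N :=
  Quotient.sound ⟨e⟩

theorem isZero_proj_iff (M : CM A) :
    Limits.IsZero ((proj A).obj M) ↔ Module.Free A M.obj := by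
  refine ⟨fun h => ?_, fun h => ?_⟩
  · have h1 : (proj A).map (𝟙 M) = (proj A).map (ObjectProperty.homMk 0) := h.eq_of_src _ _
    rw [CategoryTheory.Quotient.functor_map_eq_iff] at h1
    refine free_of_factorsThroughFree_id ?_
    have h2 : FactorsThroughFree (LinearMap.id - (0 : M.obj →ₗ[A] M.obj)) := h1
    rwa [sub_zero] at h2
  · refine ⟨fun Y => ⟨⟨⟨(proj A).map (Y := Y.as) (ObjectProperty.homMk 0)⟩, fun g => ?_⟩⟩,
      fun Y => ⟨⟨⟨(proj A).map (X := Y.as) (ObjectProperty.homMk 0)⟩, fun g => ?_⟩⟩⟩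
    · obtain ⟨g, rfl⟩ := (proj A).map_surjective (Y := Y.as) g
      exact CategoryTheory.Quotient.sound _ (factorsThroughFree_id_of_free.comp_left (M := M.obj)
        (g.hom.hom - (ObjectProperty.homMk 0 : M ⟶ Y.as).hom.hom))
    · obtain ⟨g, rfl⟩ := (proj A).map_surjective (X := Y.as) g
      exact CategoryTheory.Quotient.sound _ (factorsThroughFree_id_of_free.comp_right (N := M.obj)
        (g.hom.hom - (ObjectProperty.homMk 0 : Y.as ⟶ M).hom.hom))

variable [IsNoetherianRing A]

theorem IsPreTriangleFunction.eq_of_iso (hA : IsGorenstein A) {ξ : ICM A → ℤ}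
    (hξ : IsPreTriangleFunction ξ) {M N : CM A} (e : (proj A).obj M ≅ (proj A).obj N) :
    ξ (ICM.mk M) = ξ (ICM.mk N) := by
  obtain ⟨f, hf⟩ := (proj A).map_surjective e.hom
  obtain ⟨g, hg⟩ := (proj A).map_surjective e.inv
  have h1 : (proj A).map (𝟙 M) = (proj A).map (f ≫ g) := by
    rw [Functor.map_comp, hf, hg, e.hom_inv_id, CategoryTheory.Functor.map_id]
  have h2 : (proj A).map (𝟙 N) = (proj A).map (g ≫ f) := by
    rw [Functor.map_comp, hf, hg, e.inv_hom_id, CategoryTheory.Functor.map_id]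
  rw [CategoryTheory.Quotient.functor_map_eq_iff] at h1 h2
  obtain ⟨n, K, hK, ⟨φ⟩⟩ := exists_equiv_prod_free (f := f.hom.hom) (g := g.hom.hom) h1 h2
  let F : CM A := ⟨ModuleCat.of A (Fin n → A), isMCM_pi hA n⟩
  let K' : CM A := ⟨ModuleCat.of A K, isMCM_of_free hA K⟩
  have h3 : ξ (ICM.mk F) = 0 := (hξ.eq_zero_iff F).2 (inferInstanceAs (Module.Free A (Fin n → A)))
  have h4 : ξ (ICM.mk K') = 0 := (hξ.eq_zero_iff K').2 hK
  have h5 : ICM.mk (N.sum F) = ICM.mk (M.sum K') := ICM.mk_eq_of_equiv φ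
  have h6 := hξ.add N F
  rw [h5, hξ.add] at h6
  omega

end Invariance

/-! ### Pushouts of modules in terms of elements -/

section Pushout

variable {A : Type u} [CommRing A] {M N Q C : ModuleCat.{u} A} {f : M ⟶ N} {i : M ⟶ Q}
  {i' : N ⟶ C} {q : Q ⟶ C} (h : IsPushout f i i' q)

include h

theorem exists_desc_of_isPushout {X : Type u} [AddCommGroup X] [Module A X] (α : N →ₗ[A] X)
    (β : Q →ₗ[A] X) (hαβ : ∀ m, α (f m) = β (i m)) :
    ∃ θ : C →ₗ[A] X, (∀ n, θ (i' n) = α n) ∧ ∀ x, θ (q x) = β x := by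
  have w : f ≫ ModuleCat.ofHom α = i ≫ ModuleCat.ofHom β := by
    ext m
    exact hαβ m
  exact ⟨(h.desc _ _ w).hom, fun n => ConcreteCategory.congr_hom (h.inl_desc _ _ w) n,
    fun x => ConcreteCategory.congr_hom (h.inr_desc _ _ w) x⟩

theorem isPushout_comm_apply (m : M) : i' (f m) = q (i m) :=
  ConcreteCategory.congr_hom h.w m

theorem exists_add_of_isPushout (c : C) : ∃ n x, i' n + q x = c := by
  let R := LinearMap.range (i'.hom.coprod q.hom)
  have h1 : ModuleCat.ofHom R.mkQ = 0 := by
    refine h.hom_ext ?_ ?_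
    · ext n
      exact (Submodule.Quotient.mk_eq_zero R).2 ⟨(n, 0), by simp; rfl⟩
    · ext x
      exact (Submodule.Quotient.mk_eq_zero R).2 ⟨(0, x), by simp; rfl⟩
  have h2 : c ∈ R := (Submodule.Quotient.mk_eq_zero R).1 (ConcreteCategory.congr_hom h1 c)
  obtain ⟨⟨n, x⟩, hc⟩ := h2
  exact ⟨n, x, hc⟩

/-- The universal property maps `C` to the explicit model `(N ⊕ Q)/{(f m, -i m)}`, where the class
of `(n, x)` must vanish. -/
theorem exists_of_isPushout_add_eq_zero {n : N} {x : Q} (hx : i' n + q x = 0) :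
    ∃ m, f m = n ∧ i m = -x := by
  let R := LinearMap.range (f.hom.prod (-i.hom))
  obtain ⟨θ, h1, h2⟩ := exists_desc_of_isPushout h (R.mkQ ∘ₗ LinearMap.inl A N Q)
    (R.mkQ ∘ₗ LinearMap.inr A N Q) (fun m => by
      rw [← sub_eq_zero, LinearMap.comp_apply, LinearMap.comp_apply, ← map_sub]
      exact (Submodule.Quotient.mk_eq_zero R).2 ⟨m, by simp⟩)
  have h3 : R.mkQ (n, x) = 0 := by
    have h4 := congrArg θ hx
    rw [map_add, h1, h2, map_zero, LinearMap.comp_apply, LinearMap.comp_apply, ← map_add] at h4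
    simpa using h4
  obtain ⟨m, hm⟩ := (Submodule.Quotient.mk_eq_zero R).1 h3
  refine ⟨m, congrArg Prod.fst hm, ?_⟩
  have h5 : -(i m) = x := congrArg Prod.snd hm
  rw [← h5, neg_neg]

end Pushout
end StableCM

namespace StableCM

/-! ### Three exact sequences from a basic triangle -/

section BasicTriangles

variable {A : Type u} [CommRing A] [IsLocalRing A] [IsNoetherianRing A]

theorem IsPreTriangleFunction.sum_pi (hA : IsGorenstein A) {ξ : ICM A → ℤ}
    (hξ : IsPreTriangleFunction ξ) (N : CM A) (n : ℕ) :
    ξ (ICM.mk (N.sum ⟨ModuleCat.of A (Fin n → A), isMCM_pi hA n⟩)) = ξ (ICM.mk N) := by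
  rw [hξ.add, (hξ.eq_zero_iff ⟨ModuleCat.of A (Fin n → A), isMCM_pi hA n⟩).2
    (inferInstanceAs (Module.Free A (Fin n → A))), add_zero]

variable (hA : IsGorenstein A) (hΩ : CosyzygyClosed A) {ξ : ICM A → ℤ}
  (hξ : IsPreTriangleFunction ξ) {M N C : CM A} {f : M ⟶ N} {i' : N ⟶ C} {p' : C ⟶ hΩ.obj M}
  {q : ModuleCat.of A (Fin (dualRank A M.obj) → A) ⟶ C.obj}
  (h : IsPushout f.hom (ModuleCat.ofHom (cosyzygyIn A M.obj)) i'.hom q)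
  (hN : i'.hom ≫ p'.hom = 0) (hQ : q ≫ p'.hom = ModuleCat.ofHom (cosyzygyOut A M.obj))

include hA

theorem cosyzygyIn_injective (M : CM A) : Function.Injective (cosyzygyIn A M.obj) :=
  (cosyzygyIn_injective_and_isMCM hA M.obj M.property).1

include hξ h

/-- The sequence `0 → M → N ⊕ Q → C → 0` of a pushout. -/
theorem IsPreTriangleFunction.le_of_isPushout₁ :
    ξ (ICM.mk N) ≤ ξ (ICM.mk M) + ξ (ICM.mk C) := by
  rw [← hξ.sum_pi hA N (dualRank A M.obj)]
  refine hξ.subadd M _ C (f.hom.hom.prod (-cosyzygyIn A M.obj)) (i'.hom.hom.coprod q.hom) ?_ ?_ ?_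
  · intro x y hxy
    exact cosyzygyIn_injective hA M (neg_injective (congrArg Prod.snd hxy))
  · rintro ⟨n, x⟩
    constructor
    · intro hx
      obtain ⟨m, rfl, hm⟩ := exists_of_isPushout_add_eq_zero h (n := n) (x := x) hx
      refine ⟨m, Prod.ext rfl ?_⟩
      change -(cosyzygyIn A M.obj m) = x
      exact neg_eq_iff_eq_neg.2 hm
    · rintro ⟨m, hm⟩
      rw [← hm]
      change i'.hom (f.hom m) + q (-(cosyzygyIn A M.obj m)) = 0
      rw [isPushout_comm_apply h, map_neg]
      exact add_neg_cancel _
  · intro c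
    obtain ⟨n, x, hc⟩ := exists_add_of_isPushout h c
    exact ⟨(n, x), hc⟩

include hN hQ

/-- The sequence `0 → N → C → Ω⁻¹(M) → 0` of a pushout. -/
theorem IsPreTriangleFunction.le_of_isPushout₂ :
    ξ (ICM.mk C) ≤ ξ (ICM.mk N) + ξ (ICM.mk (hΩ.obj M)) := by
  have hN' : ∀ n, p'.hom (i'.hom n) = 0 := fun n => ConcreteCategory.congr_hom hN n
  have hQ' : ∀ x, p'.hom (q x) = cosyzygyOut A M.obj x := fun x =>
    ConcreteCategory.congr_hom hQ x
  refine hξ.subadd N C (hΩ.obj M) i'.hom.hom p'.hom.hom ?_ ?_ ?_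
  · refine (injective_iff_map_eq_zero _).2 fun n hn => ?_
    have hn' : i'.hom n + q 0 = 0 := by
      rw [map_zero, add_zero]
      exact hn
    obtain ⟨m, rfl, hm⟩ := exists_of_isPushout_add_eq_zero h hn'
    have : m = 0 := cosyzygyIn_injective hA M (hm.trans (by simp))
    rw [this]
    exact map_zero f.hom.hom
  · intro c
    constructor
    · intro hc
      obtain ⟨n, x, rfl⟩ := exists_add_of_isPushout h c
      have hx : cosyzygyOut A M.obj x = 0 := by
        rw [← hQ']
        have : p'.hom (i'.hom n + q x) = 0 := hc
        rwa [map_add, hN', zero_add] at this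
      obtain ⟨m, rfl⟩ := (cosyzygy_exact M.obj x).1 hx
      refine ⟨n + f.hom m, ?_⟩
      rw [map_add]
      exact congrArg _ (isPushout_comm_apply h m)
    · rintro ⟨n, rfl⟩
      exact hN' n
  · intro y
    obtain ⟨x, rfl⟩ := cosyzygyOut_surjective M.obj y
    exact ⟨q x, hQ' x⟩

/-- The sequence `0 → C → Ω⁻¹(M) ⊕ A^n → Ω⁻¹(N) → 0` of a pushout. -/
theorem IsPreTriangleFunction.le_of_isPushout₃ :
    ξ (ICM.mk (hΩ.obj M)) ≤ ξ (ICM.mk C) + ξ (ICM.mk (hΩ.obj N)) := by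
  have hN' : ∀ n, p'.hom.hom (i'.hom n) = 0 := fun n => ConcreteCategory.congr_hom hN n
  have hQ' : ∀ x, p'.hom.hom (q x) = cosyzygyOut A M.obj x := fun x =>
    ConcreteCategory.congr_hom hQ x
  obtain ⟨c, b, hb, hc⟩ := exists_isInduced f.hom.hom
  have hb' : ∀ m, b (cosyzygyIn A M.obj m) = cosyzygyIn A N.obj (f.hom m) :=
    LinearMap.congr_fun hb
  have hc' : ∀ x, c (cosyzygyOut A M.obj x) = cosyzygyOut A N.obj (b x) :=
    LinearMap.congr_fun hc
  -- `θ : C → Aⁿ` extends the embedding of `N`. Since `p'` has kernel `N`, the pair `(p', θ)` is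
  -- injective.
  obtain ⟨θ, hθN, hθQ⟩ := exists_desc_of_isPushout h (cosyzygyIn A N.obj) b
    (fun m => (hb' m).symm)
  rw [← hξ.sum_pi hA (hΩ.obj M) (dualRank A N.obj)]
  refine hξ.subadd C _ (hΩ.obj N) (p'.hom.hom.prod θ) ((-c).coprod (cosyzygyOut A N.obj)) ?_ ?_ ?_
  · refine (injective_iff_map_eq_zero _).2 fun z hz => ?_
    have hz1 : p'.hom.hom z = 0 := congrArg Prod.fst hz
    have hz2 : θ z = 0 := congrArg Prod.snd hz
    obtain ⟨n, x, rfl⟩ := exists_add_of_isPushout h z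
    rw [map_add, hN', zero_add, hQ'] at hz1
    obtain ⟨m, rfl⟩ := (cosyzygy_exact M.obj x).1 hz1
    have hq : i'.hom n + q (cosyzygyIn A M.obj m) = i'.hom (n + f.hom m) := by
      rw [map_add]
      exact congrArg _ (isPushout_comm_apply h m).symm
    rw [hq] at hz2 ⊢
    rw [hθN] at hz2
    rw [cosyzygyIn_injective hA N (hz2.trans (map_zero _).symm), map_zero]
  · rintro ⟨y, x⟩
    constructor
    · intro hyx
      obtain ⟨w, rfl⟩ := cosyzygyOut_surjective M.obj y
      have h1 : -c (cosyzygyOut A M.obj w) + cosyzygyOut A N.obj x = 0 := hyx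
      rw [hc', ← map_neg, ← map_add] at h1
      obtain ⟨n, hn⟩ := (cosyzygy_exact N.obj _).1 h1
      refine ⟨i'.hom n + q w, Prod.ext ?_ ?_⟩
      · change p'.hom.hom (i'.hom n + q w) = cosyzygyOut A M.obj w
        rw [map_add, hN', zero_add, hQ']
      · change θ (i'.hom n + q w) = x
        rw [map_add, hθN, hθQ, hn]
        abel
    · rintro ⟨z, hz⟩
      rw [← hz]
      change -c (p'.hom.hom z) + cosyzygyOut A N.obj (θ z) = 0
      obtain ⟨n, w, rfl⟩ := exists_add_of_isPushout h z
      rw [map_add, map_add, hN', zero_add, hQ', hθN, hθQ, map_add, hc',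
        (cosyzygy_exact N.obj).apply_apply_eq_zero, zero_add]
      exact neg_add_cancel _
  · intro y
    obtain ⟨x, rfl⟩ := cosyzygyOut_surjective N.obj y
    refine ⟨(0, x), ?_⟩
    change (-c) 0 + cosyzygyOut A N.obj x = _
    rw [map_zero, zero_add]

end BasicTriangles

/-! ### The induced triangle function -/

section Main

variable {A : Type u} [CommRing A] [IsLocalRing A] [IsNoetherianRing A]

theorem cosyzygyClosed_of_isGorenstein (hA : IsGorenstein A) : CosyzygyClosed A := fun M =>
  (cosyzygyIn_injective_and_isMCM hA M.obj M.property).2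

/-- The function induced on stable isomorphism classes by a pre-triangle function. -/
def IsPreTriangleFunction.stable (hA : IsGorenstein A) {ξ : ICM A → ℤ}
    (hξ : IsPreTriangleFunction ξ) : StableICM A → ℤ :=
  Quotient.lift (fun M : Stable A => ξ (ICM.mk M.as)) fun _ _ ⟨e⟩ => hξ.eq_of_iso hA e

/-- The inequalities see only the isomorphism classes of objects, so the commuting squares of a
triangle isomorphism are discarded and each case reduces to a basic triangle. -/
theorem IsPreTriangleFunction.isTriangleFunction_stable (hA : IsGorenstein A)
    (hΩ : CosyzygyClosed A) {ξ : ICM A → ℤ} (hξ : IsPreTriangleFunction ξ) :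
    IsTriangleFunction hΩ (hξ.stable hA) where
  nonneg M := hξ.nonneg M.as
  eq_zero_iff M := (hξ.eq_zero_iff M.as).trans (isZero_proj_iff M.as).symm
  add M N := hξ.add M N
  subadd₁ := by
    rintro T ⟨S, ⟨M, N, C, f, i', p', q, h, hN, hQ, rfl⟩, a, b, c, -⟩
    rw [StableICM.mk_eq_of_iso a, StableICM.mk_eq_of_iso b, StableICM.mk_eq_of_iso c]
    exact hξ.le_of_isPushout₁ hA h
  subadd₂ := by
    rintro T ⟨S, ⟨M, N, C, f, i', p', q, h, hN, hQ, rfl⟩, a, b, c, -⟩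
    rw [StableICM.mk_eq_of_iso b, StableICM.mk_eq_of_iso c,
      StableICM.mk_eq_of_iso ((translation hΩ).mapIso a)]
    exact hξ.le_of_isPushout₂ hA hΩ h hN hQ
  subadd₃ := by
    rintro T ⟨S, ⟨M, N, C, f, i', p', q, h, hN, hQ, rfl⟩, a, b, c, -⟩
    rw [StableICM.mk_eq_of_iso c, StableICM.mk_eq_of_iso ((translation hΩ).mapIso a),
      StableICM.mk_eq_of_iso ((translation hΩ).mapIso b)]
    exact hξ.le_of_isPushout₃ hA hΩ h hN hQ

end Main

end StableCM

theorem mainTheorem6 {A : Type u} [CommRing A] [IsLocalRing A] [IsNoetherianRing A]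
    (hA : StableCM.IsGorenstein A) :
    ∃ hΩ : StableCM.CosyzygyClosed A,
      ∀ ξ : StableCM.ICM A → ℤ, StableCM.IsPreTriangleFunction ξ →
        ∃ ξ' : StableCM.StableICM A → ℤ,
          (∀ M : StableCM.CM A, ξ' (StableCM.StableICM.mk ((StableCM.proj A).obj M)) =
            ξ (StableCM.ICM.mk M)) ∧
          StableCM.IsTriangleFunction hΩ ξ' := by
  exact ⟨StableCM.cosyzygyClosed_of_isGorenstein hA, fun ξ hξ =>
    ⟨hξ.stable hA, fun _ => rfl, hξ.isTriangleFunction_stable hA _⟩⟩
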